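/- Let $n\ge 1$, $C>1$ and $\alpha\in[0,1/2)$. Consider the join-the-shortest-queue (JSQ) system with $n$ queues, arrival rate $\lambda>0$, service rates $\mu_1,\dots,\mu_n>0$, $\mu:=\sum_i\mu_i$, and abandonment rate $\gamma>0$: the continuous-time Markov chain on $\mathbb{N}^n$ that jumps from $x$ to $x+e_{i^*(x)}$ at rate $\lambda$, where $i^*(x)$ is the smallest index minimizing $x_i$, and from $x$ to $x-e_i$ at rate $\mu_i+\gamma x_i$ for every $i$ with $x_i\ge 1$. There is $\varepsilon>0$, depending only on $n$, $C$ and $\alpha$, such that the following holds for all such $\lambda,\mu_1,\dots,\mu_n$ and all sufficiently small $\gamma$, namely $0<\gamma\le\varepsilon\lambda$, for which the system is heavily overloaded, i.e. $\frac{\lambda}{\mu}-1\ge C\left(\frac{\gamma}{\mu}\right)^{\alpha}$. Let $q=(q_1,\dots,q_n)$ have a stationary distribution of the chain (a probability distribution satisfying the global balance equations), and put $\hat q_\Sigma:=\sum_i q_i-\frac{\lambda-\mu}{\gamma}$. Then for every real $p\ge 1$ the moment $\mathbb{E}|\hat q_\Sigma|^p$ is finite, $$\mathbb{E}\big[|\hat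 q_\Sigma|^p\big]^{1/p}\le\max\left\{C''_{\lambda,\mu,n}\frac{\sqrt p}{\sqrt\gamma}+C'_{\lambda,\mu,n}\,p,\ \ n\Big(A_{\lambda,\mu,n}+\frac1n\Big)\frac{p}{\log\big(1+\frac{n\gamma}{\lambda}p\big)}\right\},$$ and $$\mathbb{E}\big[|\hat q_\Sigma|^p\big]^{1/p}\ge C_{4,\lambda,\mu}\,\exp\Big(-8(15+A_{\lambda,\mu})\frac{\lambda}{\gamma p}\Big)\frac{p}{\log\big(1+\frac{p\gamma}{\lambda}\big)}.$$ The constants are $$A_{\lambda,\mu,n}=\frac1n\Big(1+n\mu\,\Gamma\big(\tfrac{1}{1/2-\alpha}+1\big)\big(\tfrac{C}{2n\lambda}\big)^{-\frac{1}{1/2-\alpha}}\Big),\qquad C''_{\lambda,\mu,n}=2e\sqrt{2\pi},$$ $$C'_{\lambda,\mu,n}=\Big(A_{\lambda,\mu,n}+\frac1n\Big)\sqrt{2\big(\tfrac1n e^n-1-\tfrac1n\big)\lambda}\cdot 2e\sqrt{2\pi},$$ $$A_{\lambda,\mu}=1+\sqrt2\,\frac{\lambda}{\mu}\max\Big\{e,\frac{(1+C)(2+C)}{C^2+C-1}\Big\},\qquad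 C_{4,\lambda,\mu}=\frac{29}{69}\cdot 2\cdot e^{-9(15+A_{\lambda,\mu})}.$$ -/

import Mathlib

open MeasureTheory

namespace JSQ

/-- Server `i` is the one that receives an arriving job in state `x`: its queue is shortest, and
ties are broken in favour of the smallest index. -/
def IsShortest {n : ℕ} (x : Fin n → ℕ) (i : Fin n) : Prop :=
  (∀ j, x i ≤ x j) ∧ ∀ j, x j = x i → i ≤ j

/-- With at least one server, the server that receives an arriving job is well defined. -/
theorem existsUnique_isShortest {n : ℕ} (hn : 0 < n) (x : Fin n → ℕ) : ∃! i, IsShortest x i := by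
  classical
  have : Nonempty (Fin n) := ⟨⟨0, hn⟩⟩
  obtain ⟨m, hm⟩ := Finite.exists_min x
  have hne : (Finset.univ.filter fun i => x i = x m).Nonempty := ⟨m, by simp⟩
  have hmem := Finset.min'_mem _ hne
  simp only [Finset.mem_filter, Finset.mem_univ, true_and] at hmem
  refine ⟨_, ⟨fun j => hmem.trans_le (hm j), fun j hj => Finset.min'_le _ _ ?_⟩, ?_⟩
  · simp [hj, hmem]
  · intro i hi
    apply le_antisymm
    · exact hi.2 _ (le_antisymm (hmem.trans_le (hm i)) (hi.1 _))
    · exact Finset.min'_le _ _ (by simpa using le_antisymm (hi.1 m) (hm i))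

open Classical in
/-- Transition rate from `x` to `y` of the continuous-time Markov chain of queue lengths (jobs in
service included) under join-the-shortest-queue: arrivals at rate `lam` join the shortest queue,
and each nonempty queue `i` loses a job at rate `mu i + gam * x i` (service or abandonment). -/
noncomputable def rate {n : ℕ} (lam gam : ℝ) (mu : Fin n → ℝ) (x y : Fin n → ℕ) : ℝ :=
  (∑ i, if IsShortest x i ∧ y = x + Pi.single i 1 then lam else 0) +
    ∑ i, if x = y + Pi.single i 1 then mu i + gam * x i else 0

/-- `π` is a stationary distribution of the chain: a probability measure satisfying the global
balance equations `π Q = 0`, flow into each state being equal to flow out of it. (Both sums have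
only finitely many nonzero terms. As the total arrival rate is bounded, the chain does not explode,
so that this is the same as invariance under its transition semigroup.) -/
def IsStationary {n : ℕ} (lam gam : ℝ) (mu : Fin n → ℝ) (π : Measure (Fin n → ℕ)) : Prop :=
  IsProbabilityMeasure π ∧
    ∀ y, ∑' x, π.real {x} * rate lam gam mu x y = π.real {y} * ∑' z, rate lam gam mu y z

/-- The heavily overloaded regime; `M` is the total service rate. -/
def HeavilyOverloaded (C α lam M gam : ℝ) : Prop :=
  C * (gam / M) ^ α ≤ lam / M - 1

/-- The centered total queue length. -/
noncomputable def qHat {n : ℕ} (lam gam : ℝ) (mu : Fin n → ℝ) (x : Fin n → ℕ) : ℝ :=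
  (∑ i, (x i : ℝ)) - (lam - ∑ i, mu i) / gam

/-- The constant `A_{λ,μ,n}`; `M` is the total service rate. -/
noncomputable def constA (n : ℕ) (C α lam M : ℝ) : ℝ :=
  1 / n * (1 + n * M * Real.Gamma (1 / (1 / 2 - α) + 1) *
    (C / (2 * n * lam)) ^ (-(1 / (1 / 2 - α))))

/-- The constant `C''_{λ,μ,n}`. -/
noncomputable def constC'' : ℝ := 2 * Real.exp 1 * √(2 * Real.pi)

/-- The constant `C'_{λ,μ,n}`. -/
noncomputable def constC' (n : ℕ) (C α lam M : ℝ) : ℝ :=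
  (constA n C α lam M + 1 / n) * √(2 * (1 / n * Real.exp n - 1 - 1 / n) * lam) *
    (2 * Real.exp 1 * √(2 * Real.pi))

/-- The constant `C'_{λ,μ}` (of the single-server queue). -/
noncomputable def constCSSQ (C lam M : ℝ) : ℝ :=
  lam / M * max (Real.exp 1) ((1 + C) * (2 + C) / (C ^ 2 + C - 1))

/-- The constant `A_{λ,μ}`. -/
noncomputable def constASSQ (C lam M : ℝ) : ℝ := 1 + constCSSQ C lam M * √2

/-- The constant `C_{4,λ,μ}`. -/
noncomputable def constC4 (C lam M : ℝ) : ℝ :=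
  29 / 69 * 2 * Real.exp (-9 * (15 + constASSQ C lam M))

end JSQ

/-! Measure time in units of `1 / lam`, so that arrivals have rate `1`, abandonment has rate `g =
gam / lam`, and the total service rate `ρ` is at most `1` by overload. By Tonelli, global balance
makes the generator integrate to zero under `π`. Applied to the indicator of `total ≤ k`, this
balances the flow across the cut between levels `k` and `k + 1`. The departure rate at total `t` is
at least `g * t` and at most `g * t + ρ`, so `cut_le` bounds ratios of consecutive level masses on
both sides.

The lower bound on the departure rate dominates the factorial moments by those of a Poisson law of
mean `1 / g`. Hence `E (1 + s) ^ total ≤ exp (s / g)`, every moment is finite, and the `p`-th norm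
of `qHat` is at most `2 ^ (1 / p) * (p / log (1 + g * p))`.

The stated upper bound follows in three ranges. If `g * p * n ^ 2 ≤ 1`, the second term of the
maximum is at least `2 / (n * g)`. This bounds the norm because the tails of `qHat` beyond `3 / (2 *
n * g)` are exponentially small (`integral_exp_upper_tail_le`, `integral_exp_lower_tail_le`). The
upper tail needs a Lyapunov function charging short queues: an empty queue loses its service rate,
but then arrivals join an empty queue and lower the charge. If `1 ≤ g * p * n ^ 2` and `g * p ≤ n ^
2`, the Poisson bound lies below the first term, by AM-GM on its two summands. If `g * p ≥ n ^ 2`,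
then `log (1 + n * g * p) ≤ 3 / 2 * log (1 + g * p)`, and the Poisson bound lies below the second
term.

For the lower bound, some level below `2 / g` has mass at least `g / 6`. Climbing from it by
`cut_le` bounds the mass of a single level where `qHat ≥ p / log (1 + g * p)`, and that level alone
yields the estimate. -/

namespace JSQ

open scoped ENNReal

variable {n : ℕ}

/-! ### The generator at unit arrival rate -/

/-- The server that receives an arriving job. -/
noncomputable def shortest (hn : 0 < n) (x : Fin n → ℕ) : Fin n :=
  (existsUnique_isShortest hn x).exists.choose

theorem isShortest_iff (hn : 0 < n) (x : Fin n → ℕ) (i : Fin n) :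
    IsShortest x i ↔ i = shortest hn x := by
  have h := (existsUnique_isShortest hn x).exists.choose_spec
  exact ⟨fun hi => (existsUnique_isShortest hn x).unique hi h, fun hi => hi ▸ h⟩

theorem shortest_le (hn : 0 < n) (x : Fin n → ℕ) (j : Fin n) : x (shortest hn x) ≤ x j :=
  ((isShortest_iff hn x _).2 rfl).1 j

/-- The total number of jobs. -/
def total (x : Fin n → ℕ) : ℕ := ∑ i, x i

theorem total_add_single (x : Fin n → ℕ) (i : Fin n) :
    total (x + Pi.single i 1) = total x + 1 := by
  simp [total, Finset.sum_add_distrib]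

theorem sub_single_add_single {x : Fin n → ℕ} {i : Fin n} (h : x i ≠ 0) :
    x - Pi.single i 1 + Pi.single i 1 = x := by
  classical
  ext j
  by_cases hj : j = i
  · subst hj
    simp
    omega
  · simp [hj]

theorem total_sub_single {x : Fin n → ℕ} {i : Fin n} (h : x i ≠ 0) :
    total (x - Pi.single i 1) + 1 = total x := by
  rw [← total_add_single, sub_single_add_single h]

/-- The departure rate from queue `i`. -/
noncomputable def depRate (g : ℝ) (mu : Fin n → ℝ) (x : Fin n → ℕ) (i : Fin n) : ℝ :=
  if x i = 0 then 0 else mu i + g * x i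

theorem depRate_nonneg {g : ℝ} {mu : Fin n → ℝ} (hg : 0 ≤ g) (hmu : ∀ i, 0 ≤ mu i)
    (x : Fin n → ℕ) (i : Fin n) : 0 ≤ depRate g mu x i := by
  unfold depRate
  split_ifs
  · rfl
  · have := hmu i
    positivity

theorem rate_eq (hn : 0 < n) (g : ℝ) (mu : Fin n → ℝ) (x y : Fin n → ℕ) :
    rate 1 g mu x y = (if y = x + Pi.single (shortest hn x) 1 then 1 else 0) +
      ∑ i, if y = x - Pi.single i 1 then depRate g mu x i else 0 := by
  classical
  unfold rate
  congr 1
  · simp only [isShortest_iff hn]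
    rw [Finset.sum_eq_single (shortest hn x)]
    · simp
    · intro b _ hb
      simp [hb]
    · simp
  · refine Finset.sum_congr rfl fun i _ => ?_
    unfold depRate
    by_cases h0 : x i = 0
    · have : x ≠ y + Pi.single i 1 := by
        intro h
        rw [h] at h0
        simp at h0
      simp [h0, this]
    · have : x = y + Pi.single i 1 ↔ y = x - Pi.single i 1 := by
        constructor
        · rintro rfl
          simp
        · rintro rfl
          rw [sub_single_add_single h0]
      simp [h0, this]

theorem rate_nonneg (hn : 0 < n) {g : ℝ} {mu : Fin n → ℝ} (hg : 0 ≤ g) (hmu : ∀ i, 0 ≤ mu i)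
    (x y : Fin n → ℕ) : 0 ≤ rate 1 g mu x y := by
  rw [rate_eq hn]
  refine add_nonneg (by split_ifs <;> norm_num) (Finset.sum_nonneg fun i _ => ?_)
  split_ifs
  · exact depRate_nonneg hg hmu x i
  · rfl

/-- The values of `f` after a jump from `x`, weighted by the jump rates. -/
noncomputable def jump (hn : 0 < n) (g : ℝ) (mu : Fin n → ℝ) (f : (Fin n → ℕ) → ℝ)
    (x : Fin n → ℕ) : ℝ :=
  f (x + Pi.single (shortest hn x) 1) + ∑ i, depRate g mu x i * f (x - Pi.single i 1)

/-- The total departure rate. -/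
noncomputable def depSum (g : ℝ) (mu : Fin n → ℝ) (x : Fin n → ℕ) : ℝ := ∑ i, depRate g mu x i

theorem hasSum_rate_mul (hn : 0 < n) (g : ℝ) (mu : Fin n → ℝ) (f : (Fin n → ℕ) → ℝ)
    (x : Fin n → ℕ) : HasSum (fun y => rate 1 g mu x y * f y) (jump hn g mu f x) := by
  classical
  simp only [rate_eq hn, add_mul, Finset.sum_mul]
  refine HasSum.add ?_ (hasSum_sum fun i _ => ?_)
  · convert hasSum_ite_eq (x + Pi.single (shortest hn x) 1)
      (f (x + Pi.single (shortest hn x) 1)) using 2 with y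
    split_ifs with h <;> simp [h]
  · convert hasSum_ite_eq (x - Pi.single i 1) (depRate g mu x i * f (x - Pi.single i 1)) using 2
      with y
    split_ifs with h <;> simp [h]

theorem tsum_rate (hn : 0 < n) (g : ℝ) (mu : Fin n → ℝ) (x : Fin n → ℕ) :
    ∑' y, rate 1 g mu x y = 1 + depSum g mu x := by
  simpa [jump, depSum] using (hasSum_rate_mul hn g mu (fun _ => 1) x).tsum_eq

theorem summable_mul_rate (g : ℝ) (mu : Fin n → ℝ) (w : (Fin n → ℕ) → ℝ)
    (y : Fin n → ℕ) : Summable fun x => w x * rate 1 g mu x y := by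
  classical
  refine summable_of_hasFiniteSupport
    (((Set.finite_range fun i => y - Pi.single i 1).union
      (Set.finite_range fun i => y + Pi.single i 1)).subset fun x hx => ?_)
  by_contra hc
  simp only [Set.mem_union, Set.mem_range, not_or, not_exists] at hc
  apply hx
  have h1 : ∀ i, ¬ (IsShortest x i ∧ y = x + Pi.single i 1) := by
    rintro i ⟨-, rfl⟩
    exact hc.1 i (by simp)
  have h2 : ∀ i, ¬ (x = y + Pi.single i 1) := fun i h => hc.2 i h.symm
  simp [rate, h1, h2]

/-- Tonelli on the double sum of `π x * rate x y * f y`: summing over `y` first gives the left side,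
over `x` first gives the right side by global balance. Nonnegativity of `f` replaces any
integrability assumption. -/
theorem lintegral_jump (hn : 0 < n) {g : ℝ} {mu : Fin n → ℝ} (hg : 0 ≤ g)
    (hmu : ∀ i, 0 ≤ mu i) {π : Measure (Fin n → ℕ)} (hπ : IsStationary 1 g mu π)
    {f : (Fin n → ℕ) → ℝ} (hf : ∀ x, 0 ≤ f x) :
    ∫⁻ x, ENNReal.ofReal (jump hn g mu f x) ∂π =
      ∫⁻ x, ENNReal.ofReal ((1 + depSum g mu x) * f x) ∂π := by
  obtain ⟨hprob, hbal⟩ := hπ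
  have hr := rate_nonneg hn hg hmu
  have h1 : ∀ x, ENNReal.ofReal (jump hn g mu f x) * π {x} =
      ∑' y, ENNReal.ofReal (π.real {x} * rate 1 g mu x y * f y) := by
    intro x
    have hs := hasSum_rate_mul hn g mu f x
    rw [← hs.tsum_eq, ENNReal.ofReal_tsum_of_nonneg (fun y => mul_nonneg (hr x y) (hf y))
      hs.summable, ← ENNReal.tsum_mul_right]
    refine tsum_congr fun y => ?_
    rw [mul_assoc, ENNReal.ofReal_mul (p := π.real {x}) measureReal_nonneg, mul_comm,
      ofReal_measureReal]
  have h2 : ∀ y, ENNReal.ofReal ((1 + depSum g mu y) * f y) * π {y} =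
      ∑' x, ENNReal.ofReal (π.real {x} * rate 1 g mu x y * f y) := by
    intro y
    have hs := (summable_mul_rate g mu (fun x => π.real {x}) y).mul_right (f y)
    rw [← ENNReal.ofReal_tsum_of_nonneg (fun x => mul_nonneg (mul_nonneg measureReal_nonneg
      (hr x y)) (hf y)) hs, tsum_mul_right, hbal y, tsum_rate hn, mul_assoc,
      ENNReal.ofReal_mul (p := π.real {y}) measureReal_nonneg, mul_comm, ofReal_measureReal]
  rw [lintegral_countable', lintegral_countable']
  simp only [h1, h2]
  exact ENNReal.tsum_comm

theorem jump_nonneg (hn : 0 < n) {g : ℝ} {mu : Fin n → ℝ} (hg : 0 ≤ g)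
    (hmu : ∀ i, 0 ≤ mu i) {f : (Fin n → ℕ) → ℝ} (hf : ∀ x, 0 ≤ f x) (x : Fin n → ℕ) :
    0 ≤ jump hn g mu f x :=
  add_nonneg (hf _) (Finset.sum_nonneg fun i _ => mul_nonneg (depRate_nonneg hg hmu x i) (hf _))

theorem depSum_nonneg {g : ℝ} {mu : Fin n → ℝ} (hg : 0 ≤ g)
    (hmu : ∀ i, 0 ≤ mu i) (x : Fin n → ℕ) : 0 ≤ depSum g mu x :=
  Finset.sum_nonneg fun i _ => depRate_nonneg hg hmu x i

/-- The generator of the chain integrates to zero against a stationary distribution. -/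
theorem integral_generator (hn : 0 < n) {g : ℝ} {mu : Fin n → ℝ} (hg : 0 ≤ g)
    (hmu : ∀ i, 0 ≤ mu i) {π : Measure (Fin n → ℕ)} (hπ : IsStationary 1 g mu π)
    {f : (Fin n → ℕ) → ℝ} (hf : ∀ x, 0 ≤ f x)
    (hi : Integrable (fun x => (1 + depSum g mu x) * f x) π) :
    Integrable (fun x => jump hn g mu f x - (1 + depSum g mu x) * f x) π ∧
      ∫ x, (jump hn g mu f x - (1 + depSum g mu x) * f x) ∂π = 0 := by
  have h := lintegral_jump hn hg hmu hπ hf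
  have h0 := jump_nonneg hn hg hmu hf
  have h1 : ∀ x, 0 ≤ (1 + depSum g mu x) * f x := fun x =>
    mul_nonneg (by linarith [depSum_nonneg hg hmu x]) (hf x)
  have hj : Integrable (jump hn g mu f) π := by
    refine ⟨Measurable.of_discrete.aestronglyMeasurable, ?_⟩
    rw [hasFiniteIntegral_iff_ofReal (Filter.Eventually.of_forall h0), h,
      ← hasFiniteIntegral_iff_ofReal (Filter.Eventually.of_forall h1)]
    exact hi.2
  refine ⟨hj.sub hi, ?_⟩
  rw [integral_sub hj hi, integral_eq_lintegral_of_nonneg_ae (Filter.Eventually.of_forall h0)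
    hj.1, integral_eq_lintegral_of_nonneg_ae (Filter.Eventually.of_forall h1) hi.1, h, sub_self]

/-! ### Departure rates and cut equations -/

theorem depSum_le {g : ℝ} {mu : Fin n → ℝ} (hmu : ∀ i, 0 ≤ mu i) (x : Fin n → ℕ) :
    depSum g mu x ≤ g * total x + ∑ i, mu i := by
  unfold depSum total depRate
  push_cast
  rw [Finset.mul_sum, ← Finset.sum_add_distrib]
  refine Finset.sum_le_sum fun i _ => ?_
  split_ifs with h
  · simp [h, hmu i]
  · linarith

theorem le_depSum {g : ℝ} {mu : Fin n → ℝ} (hmu : ∀ i, 0 ≤ mu i) (x : Fin n → ℕ) :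
    g * total x ≤ depSum g mu x := by
  unfold depSum total depRate
  push_cast
  rw [Finset.mul_sum]
  refine Finset.sum_le_sum fun i _ => ?_
  split_ifs with h
  · simp [h]
  · linarith [hmu i]

theorem jump_comp_total (hn : 0 < n) (g : ℝ) (mu : Fin n → ℝ) (φ : ℕ → ℝ) (x : Fin n → ℕ) :
    jump hn g mu (fun x => φ (total x)) x =
      φ (total x + 1) + depSum g mu x * φ (total x - 1) := by
  simp only [jump, depSum, total_add_single, Finset.sum_mul]
  congr 1
  refine Finset.sum_congr rfl fun i _ => ?_
  by_cases h : x i = 0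
  · simp [depRate, h]
  · rw [← total_sub_single h]
    simp

theorem integrable_of_bounded {π : Measure (Fin n → ℕ)} [IsFiniteMeasure π]
    {f : (Fin n → ℕ) → ℝ} (B : ℝ) (h : ∀ x, |f x| ≤ B) : Integrable f π :=
  Integrable.of_bound Measurable.of_discrete.aestronglyMeasurable B
    (Filter.Eventually.of_forall h)

theorem depSum_eq_zero {g : ℝ} {mu : Fin n → ℝ} {x : Fin n → ℕ} (h : total x = 0) :
    depSum g mu x = 0 := by
  refine Finset.sum_eq_zero fun i _ => ?_
  have h1 : x i ≤ total x :=
    Finset.single_le_sum (f := x) (fun _ _ => Nat.zero_le _) (Finset.mem_univ i)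
  have h2 : x i = 0 := by omega
  simp [depRate, h2]

/-- The flow across the cut between total queue length `k` and `k + 1` is balanced. -/
theorem cut_balance (hn : 0 < n) {g : ℝ} {mu : Fin n → ℝ} (hg : 0 ≤ g)
    (hmu : ∀ i, 0 ≤ mu i) {π : Measure (Fin n → ℕ)} (hπ : IsStationary 1 g mu π) (k : ℕ) :
    ∫ x, (if total x = k + 1 then depSum g mu x else 0) ∂π = π.real {x | total x = k} := by
  have := hπ.1
  -- Only arrivals at level `k` and departures at level `k + 1` change this indicator. Its support
  -- also keeps the unbounded departure rate under control.
  set φ : ℕ → ℝ := fun j => if j ≤ k then 1 else 0 with hφ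
  have hφ0 : ∀ j, 0 ≤ φ j := fun j => by simp only [hφ]; split_ifs <;> norm_num
  have hb : ∀ x : Fin n → ℕ, |(1 + depSum g mu x) * φ (total x)| ≤ 1 + (g * k + ∑ i, mu i) := by
    intro x
    rw [abs_of_nonneg (mul_nonneg (by linarith [depSum_nonneg hg hmu x]) (hφ0 _))]
    simp only [hφ]
    split_ifs with h
    · have h1 := depSum_le (g := g) hmu x
      have h2 : g * total x ≤ g * k := by gcongr
      linarith
    · have : 0 ≤ ∑ i, mu i := Finset.sum_nonneg fun i _ => hmu i
      have : 0 ≤ g * k := by positivity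
      linarith
  obtain ⟨-, h⟩ := integral_generator hn hg hmu hπ (f := fun x => φ (total x)) (fun x => hφ0 _)
    (integrable_of_bounded _ hb)
  have hi : Integrable (fun x : Fin n → ℕ => if total x = k + 1 then depSum g mu x else 0) π := by
    refine integrable_of_bounded (g * (k + 1) + ∑ i, mu i) fun x => ?_
    have h0 : 0 ≤ ∑ i, mu i := Finset.sum_nonneg fun i _ => hmu i
    split_ifs with h
    · rw [abs_of_nonneg (depSum_nonneg hg hmu x)]
      have h1 := depSum_le (g := g) hmu x
      rw [h] at h1
      push_cast at h1
      linarith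
    · rw [abs_zero]
      positivity
  have h1 : π.real {x | total x = k} = ∫ x, (if total x = k then (1 : ℝ) else 0) ∂π := by
    rw [← integral_indicator_one (MeasurableSet.of_discrete)]
    congr 1 with x
    simp [Set.indicator]
  have hi1 : Integrable (fun x : Fin n → ℕ => if total x = k then (1 : ℝ) else 0) π :=
    integrable_of_bounded 1 fun x => by split_ifs <;> norm_num
  rw [h1, ← sub_eq_zero, ← integral_sub hi hi1]
  refine Eq.trans ?_ h
  congr 1 with x
  rw [jump_comp_total]
  rcases Nat.eq_zero_or_pos (total x) with h0 | h0
  · have hd : depSum g mu x = 0 := depSum_eq_zero h0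
    simp only [hφ, h0, hd]
    rcases Nat.eq_zero_or_pos k with hk | hk
    · simp [hk]
    · have h2 : 1 ≤ k := hk
      have h3 : k ≠ 0 := by omega
      simp [h2, h3.symm]
  · obtain ⟨m, hm⟩ : ∃ m, total x = m + 1 := ⟨total x - 1, by omega⟩
    simp only [hφ, hm, Nat.add_sub_cancel]
    rcases lt_trichotomy m k with h2 | h2 | h2
    · rcases eq_or_ne (m + 1) k with h3 | h3
      · subst h3
        simp
      · have : m + 1 + 1 ≤ k := by omega
        simp [this, h2.ne, h3, h2.le, Nat.succ_le_of_lt h2]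
    · subst h2
      simp
    · have h3 : ¬ m + 1 ≤ k := by omega
      have h4 : ¬ m + 1 + 1 ≤ k := by omega
      have h5 : ¬ m + 1 = k := by omega
      simp [h3, h4, h5, h2.ne', h2.not_ge]

theorem measureReal_total_eq (π : Measure (Fin n → ℕ)) (k : ℕ) (c : ℝ) :
    ∫ x, (if total x = k then c else 0) ∂π = c * π.real {x | total x = k} := by
  have : (fun x : Fin n → ℕ => if total x = k then c else 0) =
      Set.indicator {x | total x = k} fun _ => c := by
    ext x
    simp [Set.indicator]
  rw [this, integral_indicator_const _ MeasurableSet.of_discrete, smul_eq_mul, mul_comm]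

theorem cut_le (hn : 0 < n) {g : ℝ} {mu : Fin n → ℝ} (hg : 0 ≤ g)
    (hmu : ∀ i, 0 ≤ mu i) {π : Measure (Fin n → ℕ)} (hπ : IsStationary 1 g mu π) (k : ℕ) :
    g * (k + 1) * π.real {x | total x = k + 1} ≤ π.real {x | total x = k} ∧
      π.real {x | total x = k} ≤ (g * (k + 1) + ∑ i, mu i) * π.real {x | total x = k + 1} := by
  have := hπ.1
  have h0 : 0 ≤ ∑ i, mu i := Finset.sum_nonneg fun i _ => hmu i
  have hi : ∀ c : ℝ, Integrable (fun x : Fin n → ℕ => if total x = k + 1 then c else 0) π :=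
    fun c => integrable_of_bounded |c| fun x => by split_ifs <;> simp
  have hi' : Integrable (fun x : Fin n → ℕ => if total x = k + 1 then depSum g mu x else 0) π := by
    refine integrable_of_bounded (g * (k + 1) + ∑ i, mu i) fun x => ?_
    split_ifs with h
    · rw [abs_of_nonneg (depSum_nonneg hg hmu x)]
      have h1 := depSum_le (g := g) hmu x
      rw [h] at h1
      push_cast at h1
      linarith
    · rw [abs_zero]
      positivity
  rw [← cut_balance hn hg hmu hπ k, ← measureReal_total_eq, ← measureReal_total_eq]
  constructor
  · refine integral_mono (hi _) hi' fun x => ?_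
    dsimp only
    split_ifs with h
    · have h1 := le_depSum (g := g) hmu x
      rw [h] at h1
      push_cast at h1
      exact h1
    · rfl
  · refine integral_mono hi' (hi _) fun x => ?_
    dsimp only
    split_ifs with h
    · have h1 := depSum_le (g := g) hmu x
      rw [h] at h1
      push_cast at h1
      exact h1
    · rfl

/-! ### Domination by the Poisson distribution -/

theorem lintegral_comp_total (π : Measure (Fin n → ℕ)) (φ : ℕ → ℝ≥0∞) :
    ∫⁻ x, φ (total x) ∂π = ∑' k, φ k * π {x | total x = k} := by
  rw [← lintegral_map (μ := π) (f := φ) (g := total) Measurable.of_discrete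
    Measurable.of_discrete, lintegral_countable']
  refine tsum_congr fun k => ?_
  rw [Measure.map_apply Measurable.of_discrete MeasurableSet.of_discrete]
  rfl

/-- Factorial moments are at most those of the Poisson distribution with mean `1 / g`. -/
theorem factorial_moment_le (hn : 0 < n) {g : ℝ} {mu : Fin n → ℝ} (hg : 0 < g)
    (hmu : ∀ i, 0 ≤ mu i) {π : Measure (Fin n → ℕ)} (hπ : IsStationary 1 g mu π) (j : ℕ) :
    (j.factorial : ℝ≥0∞) * ∑' k : ℕ, (k.choose j : ℝ≥0∞) * π {x | total x = k} ≤
      ENNReal.ofReal g⁻¹ ^ j := by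
  have := hπ.1
  have hstep : ∀ k : ℕ, ((k + 1 : ℕ) : ℝ≥0∞) * π {x | total x = k + 1} ≤
      ENNReal.ofReal g⁻¹ * π {x | total x = k} := by
    intro k
    rw [← ofReal_measureReal, ← ofReal_measureReal (s := {x | total x = k}),
      ← ENNReal.ofReal_natCast, ← ENNReal.ofReal_mul (by positivity),
      ← ENNReal.ofReal_mul (by positivity)]
    refine ENNReal.ofReal_le_ofReal ?_
    have h := (cut_le hn hg.le hmu hπ k).1
    rw [le_inv_mul_iff₀ hg]
    push_cast
    linarith
  induction j with
  | zero =>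
    simp only [Nat.factorial_zero, Nat.cast_one, one_mul, Nat.choose_zero_right, pow_zero]
    have := lintegral_comp_total π (fun _ => 1)
    simp only [lintegral_const, measure_univ, one_mul] at this
    rw [← this]
  | succ j ih =>
    calc ((j + 1).factorial : ℝ≥0∞) * ∑' k : ℕ, (k.choose (j + 1) : ℝ≥0∞) * π {x | total x = k}
        = (j.factorial : ℝ≥0∞) *
          ∑' k : ℕ, (k.choose j : ℝ≥0∞) * (((k + 1 : ℕ) : ℝ≥0∞) * π {x | total x = k + 1}) := by
          -- The term `k = 0` vanishes. After the shift, `(j + 1) * (k + 1).choose (j + 1) = (k + 1)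
          -- * k.choose j` exposes the factor `k + 1` that `hstep` absorbs.
          rw [tsum_eq_zero_add' ENNReal.summable, Nat.choose_zero_succ, Nat.factorial_succ]
          simp only [Nat.cast_zero, zero_mul, zero_add]
          rw [mul_comm (j + 1), Nat.cast_mul, mul_assoc, ← ENNReal.tsum_mul_left]
          congr 1
          refine tsum_congr fun k => ?_
          rw [← mul_assoc, ← mul_assoc, ← Nat.cast_mul, ← Nat.cast_mul]
          congr 2
          rw [mul_comm (k.choose j), Nat.add_one_mul_choose_eq, mul_comm]
      _ ≤ (j.factorial : ℝ≥0∞) *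
          ∑' k : ℕ, (k.choose j : ℝ≥0∞) * (ENNReal.ofReal g⁻¹ * π {x | total x = k}) := by
          exact mul_le_mul' le_rfl
            (ENNReal.tsum_le_tsum fun k => mul_le_mul' le_rfl (hstep k))
      _ = ENNReal.ofReal g⁻¹ *
          ((j.factorial : ℝ≥0∞) * ∑' k : ℕ, (k.choose j : ℝ≥0∞) * π {x | total x = k}) := by
          rw [← ENNReal.tsum_mul_left, ← ENNReal.tsum_mul_left, ← ENNReal.tsum_mul_left]
          refine tsum_congr fun k => ?_
          ring
      _ ≤ ENNReal.ofReal g⁻¹ ^ (j + 1) := by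
          rw [pow_succ']
          gcongr

/-- The generating function is at most that of the Poisson distribution with mean `1 / g`. -/
theorem lintegral_pow_total_le (hn : 0 < n) {g : ℝ} {mu : Fin n → ℝ} (hg : 0 < g)
    (hmu : ∀ i, 0 ≤ mu i) {π : Measure (Fin n → ℕ)} (hπ : IsStationary 1 g mu π) {s : ℝ}
    (hs : 0 ≤ s) :
    ∫⁻ x, ENNReal.ofReal ((1 + s) ^ total x) ∂π ≤ ENNReal.ofReal (Real.exp (s / g)) := by
  rw [lintegral_comp_total π fun k => ENNReal.ofReal ((1 + s) ^ k)]
  have h1 : ∀ k : ℕ, ENNReal.ofReal ((1 + s) ^ k) =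
      ∑' j : ℕ, ENNReal.ofReal s ^ j * (k.choose j : ℝ≥0∞) := by
    intro k
    rw [ENNReal.ofReal_pow (by positivity), ENNReal.ofReal_add zero_le_one hs, add_comm, add_pow,
      tsum_eq_sum (s := Finset.range (k + 1))]
    · simp
    · intro j hj
      rw [Nat.choose_eq_zero_of_lt (by simpa using hj)]
      simp
  have h2 : ENNReal.ofReal (Real.exp (s / g)) =
      ∑' j : ℕ, ENNReal.ofReal ((s / g) ^ j / j.factorial) := by
    rw [← ENNReal.ofReal_tsum_of_nonneg (fun j => by positivity)
      (Real.summable_pow_div_factorial _), Real.exp_eq_exp_ℝ, NormedSpace.exp_eq_tsum_div]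
  simp only [h1, h2, ← ENNReal.tsum_mul_right]
  rw [ENNReal.tsum_comm]
  refine ENNReal.tsum_le_tsum fun j => ?_
  simp only [mul_assoc]
  rw [ENNReal.tsum_mul_left, ENNReal.ofReal_div_of_pos (by positivity), ENNReal.ofReal_natCast,
    ENNReal.le_div_iff_mul_le (by simp [Nat.factorial_ne_zero]) (by simp), div_eq_mul_inv, mul_pow,
    ENNReal.ofReal_mul (by positivity), ENNReal.ofReal_pow hs, mul_assoc,
    ENNReal.ofReal_pow (by positivity)]
  gcongr
  rw [mul_comm]
  exact factorial_moment_le hn hg hmu hπ j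

theorem integrable_pow_total (hn : 0 < n) {g : ℝ} {mu : Fin n → ℝ} (hg : 0 < g)
    (hmu : ∀ i, 0 ≤ mu i) {π : Measure (Fin n → ℕ)} (hπ : IsStationary 1 g mu π) {s : ℝ}
    (hs : 0 ≤ s) :
    Integrable (fun x => (1 + s) ^ total x) π ∧
      ∫ x, (1 + s) ^ total x ∂π ≤ Real.exp (s / g) := by
  have h := lintegral_pow_total_le hn hg hmu hπ hs
  have h0 : ∀ x : Fin n → ℕ, 0 ≤ (1 + s) ^ total x := fun x => by positivity
  have hm : AEStronglyMeasurable (fun x => (1 + s) ^ total x) π :=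
    Measurable.of_discrete.aestronglyMeasurable
  refine ⟨⟨hm, ?_⟩, ?_⟩
  · rw [hasFiniteIntegral_iff_ofReal (Filter.Eventually.of_forall h0)]
    exact h.trans_lt ENNReal.ofReal_lt_top
  · rw [integral_eq_lintegral_of_nonneg_ae (Filter.Eventually.of_forall h0) hm]
    exact ENNReal.toReal_le_of_le_ofReal (Real.exp_pos _).le h

/-- Functions of at most exponential growth are integrable. -/
theorem integrable_of_le_pow (hn : 0 < n) {g : ℝ} {mu : Fin n → ℝ} (hg : 0 < g)
    (hmu : ∀ i, 0 ≤ mu i) {π : Measure (Fin n → ℕ)} (hπ : IsStationary 1 g mu π)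
    {f : (Fin n → ℕ) → ℝ} (B s : ℝ) (hs : 0 ≤ s) (hf : ∀ x, |f x| ≤ B * (1 + s) ^ total x) :
    Integrable f π :=
  ((integrable_pow_total hn hg hmu hπ hs).1.const_mul B).mono'
    Measurable.of_discrete.aestronglyMeasurable (Filter.Eventually.of_forall hf)

theorem integral_total_le (hn : 0 < n) {g : ℝ} {mu : Fin n → ℝ} (hg : 0 < g)
    (hmu : ∀ i, 0 ≤ mu i) {π : Measure (Fin n → ℕ)} (hπ : IsStationary 1 g mu π) :
    Integrable (fun x => (total x : ℝ)) π ∧ g * ∫ x, (total x : ℝ) ∂π ≤ 1 := by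
  have h := factorial_moment_le hn hg hmu hπ 1
  simp only [Nat.factorial_one, Nat.cast_one, one_mul, Nat.choose_one_right, pow_one] at h
  rw [← lintegral_comp_total π (fun k => (k : ℝ≥0∞))] at h
  have h0 : ∀ x : Fin n → ℕ, 0 ≤ (total x : ℝ) := fun x => by positivity
  have hm : AEStronglyMeasurable (fun x => (total x : ℝ)) π :=
    Measurable.of_discrete.aestronglyMeasurable
  simp only [← ENNReal.ofReal_natCast] at h
  refine ⟨⟨hm, ?_⟩, ?_⟩
  · rw [hasFiniteIntegral_iff_ofReal (Filter.Eventually.of_forall h0)]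
    exact h.trans_lt ENNReal.ofReal_lt_top
  · rw [integral_eq_lintegral_of_nonneg_ae (Filter.Eventually.of_forall h0) hm]
    have := ENNReal.toReal_le_of_le_ofReal (by positivity) h
    exact (mul_le_mul_of_nonneg_left this hg.le).trans_eq (mul_inv_cancel₀ hg.ne')

/-! ### Moment bounds from the Poisson comparison -/

theorem qHat_eq (lam g : ℝ) (mu : Fin n → ℝ) (x : Fin n → ℕ) :
    qHat lam g mu x = total x - (lam - ∑ i, mu i) / g := by
  simp [qHat, total]

theorem mul_qHat {g : ℝ} (hg : 0 < g) (mu : Fin n → ℝ) (x : Fin n → ℕ) :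
    g * qHat 1 g mu x = g * total x - (1 - ∑ i, mu i) := by
  rw [qHat_eq, mul_sub, mul_div_cancel₀ _ hg.ne']

theorem abs_qHat_le {g : ℝ} (hg : 0 < g) {mu : Fin n → ℝ} (hmu : ∀ i, 0 ≤ mu i)
    (hmu1 : ∑ i, mu i ≤ 1) (x : Fin n → ℕ) : |qHat 1 g mu x| ≤ max (total x : ℝ) (1 / g) := by
  have h0 : 0 ≤ ∑ i, mu i := Finset.sum_nonneg fun i _ => hmu i
  have h1 : 0 ≤ (1 - ∑ i, mu i) / g := div_nonneg (by linarith) hg.le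
  have h2 : (1 - ∑ i, mu i) / g ≤ 1 / g := by gcongr; linarith
  have h3 : (0 : ℝ) ≤ total x := by positivity
  rw [qHat_eq, abs_le]
  constructor
  · linarith [le_max_right (total x : ℝ) (1 / g)]
  · linarith [le_max_left (total x : ℝ) (1 / g)]

/-- The maximum of `x ^ p * exp (-θ * x)` is attained at `x = p / θ`; the proof is `t ≤ exp (t - 1)`
at `t = θ * x / p`. -/
theorem rpow_le_exp {x θ p : ℝ} (hx : 0 ≤ x) (hθ : 0 < θ) (hp : 0 < p) :
    x ^ p ≤ (p / θ) ^ p * Real.exp (θ * x - p) := by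
  have h1 : x = p / θ * (θ * x / p) := by field_simp
  have h2 : θ * x / p ≤ Real.exp (θ * x / p - 1) := by
    have := Real.add_one_le_exp (θ * x / p - 1)
    linarith
  calc x ^ p = (p / θ * (θ * x / p)) ^ p := by rw [← h1]
    _ = (p / θ) ^ p * (θ * x / p) ^ p := Real.mul_rpow (by positivity) (by positivity)
    _ ≤ (p / θ) ^ p * Real.exp (θ * x / p - 1) ^ p := by gcongr
    _ = (p / θ) ^ p * Real.exp (θ * x - p) := by
      rw [← Real.exp_mul]
      congr 2
      field_simp

/-- The moments of the total queue length are at most those in the Poisson moment bound. -/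
theorem integral_total_rpow_le (hn : 0 < n) {g : ℝ} {mu : Fin n → ℝ} (hg : 0 < g)
    (hmu : ∀ i, 0 ≤ mu i) {π : Measure (Fin n → ℕ)} (hπ : IsStationary 1 g mu π) {p : ℝ}
    (hp : 0 < p) :
    Integrable (fun x => (total x : ℝ) ^ p) π ∧
      ∫ x, (total x : ℝ) ^ p ∂π ≤ (p / Real.log (1 + g * p)) ^ p := by
  -- With `θ = log (1 + g * p)` the exponential becomes `(1 + g * p) ^ total`, whose mean is at most
  -- `exp p`. This cancels the factor `exp (-p)`.
  have hθ : 0 < Real.log (1 + g * p) := Real.log_pos (by linarith [mul_pos hg hp])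
  have h : ∀ x : Fin n → ℕ, (total x : ℝ) ^ p ≤
      (p / Real.log (1 + g * p)) ^ p * Real.exp (-p) * (1 + g * p) ^ total x := by
    intro x
    refine (rpow_le_exp (by positivity) hθ hp).trans_eq ?_
    rw [sub_eq_add_neg, Real.exp_add, mul_comm (Real.log _), Real.exp_nat_mul,
      Real.exp_log (by positivity)]
    ring
  have hi : Integrable (fun x => (total x : ℝ) ^ p) π := by
    refine integrable_of_le_pow hn hg hmu hπ
      ((p / Real.log (1 + g * p)) ^ p * Real.exp (-p)) (g * p) (by positivity) fun x => ?_
    rw [abs_of_nonneg (by positivity)]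
    exact h x
  obtain ⟨h1, h2⟩ := integrable_pow_total hn hg hmu hπ (s := g * p) (by positivity)
  refine ⟨hi, (integral_mono hi (h1.const_mul _) h).trans ?_⟩
  rw [integral_const_mul]
  rw [mul_div_cancel_left₀ _ hg.ne'] at h2
  calc _ ≤ (p / Real.log (1 + g * p)) ^ p * Real.exp (-p) * Real.exp p := by gcongr
    _ = _ := by rw [mul_assoc, ← Real.exp_add]; simp

theorem integral_abs_qHat_rpow_le (hn : 0 < n) {g : ℝ} {mu : Fin n → ℝ} (hg : 0 < g)
    (hmu : ∀ i, 0 ≤ mu i) (hmu1 : ∑ i, mu i ≤ 1) {π : Measure (Fin n → ℕ)}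
    (hπ : IsStationary 1 g mu π) {p : ℝ} (hp : 0 < p) :
    Integrable (fun x => |qHat 1 g mu x| ^ p) π ∧
      ∫ x, |qHat 1 g mu x| ^ p ∂π ≤ 2 * (p / Real.log (1 + g * p)) ^ p := by
  have := hπ.1
  obtain ⟨h1, h2⟩ := integral_total_rpow_le hn hg hmu hπ hp
  have h : ∀ x, |qHat 1 g mu x| ^ p ≤ (total x : ℝ) ^ p + (1 / g) ^ p := by
    intro x
    refine (Real.rpow_le_rpow (abs_nonneg _) (abs_qHat_le hg hmu hmu1 x) hp.le).trans ?_
    have h3 : 0 ≤ (total x : ℝ) ^ p := by positivity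
    have h4 : 0 ≤ (1 / g) ^ p := by positivity
    rcases max_choice (total x : ℝ) (1 / g) with h5 | h5 <;> rw [h5] <;> linarith
  have hi : Integrable (fun x => |qHat 1 g mu x| ^ p) π := by
    refine (h1.add (integrable_const ((1 / g) ^ p))).mono'
      Measurable.of_discrete.aestronglyMeasurable (Filter.Eventually.of_forall fun x => ?_)
    rw [Real.norm_of_nonneg (by positivity)]
    exact h x
  refine ⟨hi, (integral_mono hi (h1.add (integrable_const ((1 / g) ^ p))) h).trans ?_⟩
  simp only [Pi.add_apply]
  rw [integral_add h1 (integrable_const _), integral_const, probReal_univ, one_smul]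
  have h6 : 1 / g ≤ p / Real.log (1 + g * p) := by
    have h7 : 0 < g * p := mul_pos hg hp
    rw [div_le_div_iff₀ hg (Real.log_pos (by linarith))]
    have := Real.log_le_sub_one_of_pos (x := 1 + g * p) (by linarith)
    linarith
  have : (1 / g) ^ p ≤ (p / Real.log (1 + g * p)) ^ p :=
    Real.rpow_le_rpow (by positivity) h6 hp.le
  linarith

/-! ### Exponential tails at scale `1 / (n * g)` -/

/-- A tail bound for a weight `U` under which the mean of `z` is at most `c`. -/
theorem integral_tail_le {X : Type*} [MeasurableSpace X] [DiscreteMeasurableSpace X]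
    {π : Measure X} [IsProbabilityMeasure π] {z U : X → ℝ} {B c d K : ℝ} (hc : 0 ≤ c)
    (hcd : c < d) (hB0 : 0 ≤ B) (hU : ∀ x, 0 ≤ U x) (hB : ∀ x, z x < d → U x ≤ B)
    (hUi : Integrable U π) (hi : Integrable (fun x => U x * (z x - c)) π)
    (hE : ∫ x, U x * (z x - c) ∂π ≤ 0)
    (hz : Integrable z π) (hK : ∫ x, |z x| ∂π ≤ K) :
    ∫ x, Set.indicator {x | d ≤ z x} U x ∂π ≤ B * (c + K) / (d - c) := by
  have hi2 : Integrable (fun x => B * (c + |z x|)) π :=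
    ((integrable_const c).add hz.abs).const_mul B
  have h : ∫ x, (d - c) * Set.indicator {x | d ≤ z x} U x ∂π ≤
      ∫ x, (U x * (z x - c) + B * (c + |z x|)) ∂π := by
    refine integral_mono ((hUi.indicator MeasurableSet.of_discrete).const_mul _)
      (hi.add hi2) fun x => ?_
    dsimp only
    have hb : 0 ≤ B * (c + |z x|) := mul_nonneg hB0 (add_nonneg hc (abs_nonneg _))
    by_cases hx : d ≤ z x
    · rw [Set.indicator_of_mem (by exact hx)]
      nlinarith [hU x]
    · rw [Set.indicator_of_notMem (by exact hx), mul_zero]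
      push Not at hx
      rcases le_total c (z x) with h1 | h1
      · have := mul_nonneg (hU x) (sub_nonneg.2 h1)
        linarith
      · have h2 : U x * (c - z x) ≤ B * (c + |z x|) :=
          mul_le_mul (hB x hx) (by linarith [neg_abs_le (z x)]) (by linarith) hB0
        linarith
  rw [integral_const_mul, integral_add hi hi2, integral_const_mul,
    integral_add (integrable_const _) hz.abs, integral_const, probReal_univ, one_smul] at h
  rw [le_div_iff₀ (by linarith)]
  have : B * (c + ∫ x, |z x| ∂π) ≤ B * (c + K) := by gcongr
  linarith

theorem prod_add_single (h : ℕ → ℝ) (x : Fin n → ℕ) (i : Fin n) :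
    (∏ j, h ((x + Pi.single i 1 : Fin n → ℕ) j)) * h (x i) = (∏ j, h (x j)) * h (x i + 1) := by
  classical
  rw [← Finset.mul_prod_erase _ _ (Finset.mem_univ i),
    ← Finset.mul_prod_erase _ (fun j => h (x j)) (Finset.mem_univ i)]
  have : ∏ j ∈ Finset.univ.erase i, h ((x + Pi.single i 1 : Fin n → ℕ) j) =
      ∏ j ∈ Finset.univ.erase i, h (x j) :=
    Finset.prod_congr rfl fun j hj => by simp [Finset.ne_of_mem_erase hj]
  rw [this]
  simp
  ring

/-- Growth of the departure rates is linear, so products with exponentials are integrable. -/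
theorem integrable_mul_of_growth (hn : 0 < n) {g : ℝ} {mu : Fin n → ℝ} (hg : 0 < g)
    (hmu : ∀ i, 0 ≤ mu i) {π : Measure (Fin n → ℕ)} (hπ : IsStationary 1 g mu π)
    {f k : (Fin n → ℕ) → ℝ} {A t a b : ℝ} (ht : 1 ≤ t) (ha : 0 ≤ a) (hb : 0 ≤ b)
    (hf : ∀ x, |f x| ≤ A * t ^ total x) (hk : ∀ x, |k x| ≤ a * total x + b) :
    Integrable (fun x => k x * f x) π := by
  refine integrable_of_le_pow hn hg hmu hπ ((a + b) * A) (2 * t - 1) (by linarith) fun x => ?_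
  have h2 : (total x : ℝ) ≤ 2 ^ total x := by exact_mod_cast Nat.lt_two_pow_self.le
  have h3 : (1 : ℝ) ≤ 2 ^ total x := one_le_pow₀ (by norm_num)
  have h4 : |k x| ≤ (a + b) * 2 ^ total x := by
    have := mul_le_mul_of_nonneg_left h2 ha
    have := mul_le_mul_of_nonneg_left h3 hb
    linarith [hk x]
  calc |k x * f x| = |k x| * |f x| := abs_mul _ _
    _ ≤ (a + b) * 2 ^ total x * (A * t ^ total x) :=
      mul_le_mul h4 (hf x) (abs_nonneg _) (by positivity)
    _ = (a + b) * A * (1 + (2 * t - 1)) ^ total x := by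
      rw [add_sub_cancel, mul_pow]
      ring

/-- Bernoulli's inequality for `(1 + 2 / N) ^ k`. It keeps the abandonment contribution of each
queue to the Lyapunov drift bounded. -/
theorem mul_pow_le {N : ℝ} (hN : 0 < N) (k : ℕ) : k * (N / (N + 2)) ^ k ≤ N / 2 := by
  have h : 1 + k * (2 / N) ≤ (1 + 2 / N) ^ k :=
    one_add_mul_le_pow (by have : 0 < 2 / N := by positivity
                           linarith) k
  have h1 : N / (N + 2) = (1 + 2 / N)⁻¹ := by field_simp
  rw [h1, inv_pow, ← div_eq_mul_inv, div_le_iff₀ (by positivity)]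
  calc (k : ℝ) ≤ N / 2 * (1 + k * (2 / N)) := by
        have : N / 2 * (1 + k * (2 / N)) = N / 2 + k := by field_simp
        linarith
    _ ≤ _ := by gcongr

/-- The Lyapunov function of the upper tail: exponential in the total queue length, with a factor
which penalises short queues. -/
noncomputable def lyapunov (n : ℕ) (x : Fin n → ℕ) : ℝ :=
  (1 + 1 / n) ^ total x * ∏ i, (1 + ((n : ℝ) / (n + 2)) ^ x i)

theorem lyapunov_add_single (x : Fin n → ℕ) (i : Fin n) :
    lyapunov n (x + Pi.single i 1) * (1 + ((n : ℝ) / (n + 2)) ^ x i) =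
      lyapunov n x * ((1 + 1 / n) * (1 + ((n : ℝ) / (n + 2)) ^ (x i + 1))) := by
  have := prod_add_single (fun k => 1 + ((n : ℝ) / (n + 2)) ^ k) x i
  unfold lyapunov
  rw [total_add_single, pow_succ, mul_assoc, this]
  ring

theorem lyapunov_pos (hn : 0 < n) (x : Fin n → ℕ) : 0 < lyapunov n x := by
  unfold lyapunov
  have : (0 : ℝ) < n := by exact_mod_cast hn
  positivity

theorem pow_le_lyapunov (hn : 0 < n) (x : Fin n → ℕ) :
    (1 + 1 / (n : ℝ)) ^ total x ≤ lyapunov n x := by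
  unfold lyapunov
  have : (0 : ℝ) < n := by exact_mod_cast hn
  refine le_mul_of_one_le_right (by positivity) ?_
  refine Finset.one_le_prod fun i _ => ?_
  have : 0 ≤ ((n : ℝ) / (n + 2)) ^ x i := by positivity
  linarith

theorem lyapunov_le (hn : 0 < n) (x : Fin n → ℕ) :
    lyapunov n x ≤ 2 ^ n * (1 + 1 / (n : ℝ)) ^ total x := by
  unfold lyapunov
  have : (0 : ℝ) < n := by exact_mod_cast hn
  rw [mul_comm]
  gcongr
  calc ∏ i, (1 + ((n : ℝ) / (n + 2)) ^ x i) ≤ ∏ i : Fin n, (2 : ℝ) := by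
        refine Finset.prod_le_prod (fun i _ => by positivity) fun i _ => ?_
        have : ((n : ℝ) / (n + 2)) ^ x i ≤ 1 :=
          pow_le_one₀ (by positivity) ((div_le_one (by positivity)).2 (by linarith))
        linarith
    _ = 2 ^ n := by simp

/-- The drift of the Lyapunov function. -/
theorem generator_lyapunov_le (hn : 0 < n) {g : ℝ} {mu : Fin n → ℝ} (hg : 0 < g)
    (hmu : ∀ i, 0 ≤ mu i) (hmu1 : ∑ i, mu i ≤ 1) (x : Fin n → ℕ) :
    jump hn g mu (lyapunov n) x - (1 + depSum g mu x) * lyapunov n x ≤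
      1 / (n + 1) * (lyapunov n x * (1 / n + g * n ^ 2 - g * qHat 1 g mu x)) := by
  have hN : (0 : ℝ) < n := by exact_mod_cast hn
  set N : ℝ := (n : ℝ) with hNdef
  set u : ℝ := N / (N + 2) with hu
  have hu0 : 0 < u := by positivity
  have hu1 : u < 1 := (div_lt_one (by positivity)).2 (by linarith)
  -- `r k` measures the relative change of the factor `1 + u ^ k`. The base `u` is chosen so that a
  -- departure changes the Lyapunov function by the relative amount `(2 * r - 1) / (n + 1)`, which
  -- vanishes at an empty queue since `r 0 = 1 / 2`.
  set r : ℕ → ℝ := fun k => u ^ k / (1 + u ^ k) with hr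
  have hr0 : ∀ k, 0 < r k := fun k => by positivity
  have hanti : ∀ k l, k ≤ l → r l ≤ r k := by
    intro k l hkl
    have : u ^ l ≤ u ^ k := pow_le_pow_of_le_one hu0.le hu1.le hkl
    simp only [hr]
    rw [div_le_div_iff₀ (by positivity) (by positivity)]
    nlinarith
  set m := x (shortest hn x) with hm
  have hadd : lyapunov n (x + Pi.single (shortest hn x) 1) =
      lyapunov n x * ((1 + 1 / N) * (1 - 2 / (N + 2) * r m)) := by
    have h := lyapunov_add_single x (shortest hn x)
    have hpos : 0 < 1 + u ^ m := by positivity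
    rw [← mul_left_inj' hpos.ne', h]
    have : 1 + u ^ (m + 1) = (1 - 2 / (N + 2) * r m) * (1 + u ^ m) := by
      simp only [hr]
      have : 2 / (N + 2) = 1 - u := by rw [hu]; field_simp; ring
      rw [this]
      field_simp
      ring
    rw [this]
    ring
  have hdep : ∀ i, depRate g mu x i * lyapunov n (x - Pi.single i 1) =
      lyapunov n x * (depRate g mu x i * (N / (N + 1) * (1 + 2 / N * r (x i)))) := by
    intro i
    by_cases h0 : x i = 0
    · simp [depRate, h0]
    have h := lyapunov_add_single (x - Pi.single i 1) i
    obtain ⟨k, hk⟩ : ∃ k, x i = k + 1 := ⟨x i - 1, by omega⟩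
    have hk' : (x - Pi.single i 1 : Fin n → ℕ) i = k := by simp [hk]
    rw [sub_single_add_single h0, hk'] at h
    have hpos : 0 < (1 + 1 / N) * (1 + u ^ (k + 1)) := by positivity
    have h2 : lyapunov n (x - Pi.single i 1) =
        lyapunov n x * (N / (N + 1) * (1 + 2 / N * r (x i))) := by
      rw [← mul_left_inj' hpos.ne', ← h, mul_assoc]
      congr 1
      simp only [hr, hk]
      have h3 : u ^ k = u ^ (k + 1) * (1 + 2 / N) := by
        have : u * (1 + 2 / N) = 1 := by rw [hu]; field_simp
        rw [pow_succ, mul_assoc, this, mul_one]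
      rw [h3]
      field_simp
      ring
    rw [h2]
    ring
  -- If queue `i` is empty, so is the shortest queue, and the `mu i` term on the right is zero: the
  -- missing service costs nothing. Otherwise `r (x i) ≤ r m`, and `x i * r (x i) ≤ N / 2` pays for
  -- abandonment.
  have hkey : ∀ i, depRate g mu x i * (2 * r (x i) - 1) ≤
      mu i * (2 * r m - 1) - g * x i + g * N := by
    intro i
    have hle := shortest_le hn x i
    by_cases h0 : x i = 0
    · have hm0 : m = 0 := by omega
      have : r 0 = 1 / 2 := by simp only [hr]; norm_num
      simp only [depRate, h0, hm0, this]
      norm_num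
      positivity
    · have h1 := hanti m (x i) hle
      have h2 : x i * r (x i) ≤ N / 2 := by
        refine le_trans ?_ (mul_pow_le hN (x i))
        gcongr
        exact div_le_self (by positivity) (by linarith [pow_pos hu0 (x i)])
      simp only [depRate, h0, if_false]
      have h3 := mul_le_mul_of_nonneg_left h1 (hmu i)
      have h4 := mul_le_mul_of_nonneg_left h2 hg.le
      nlinarith
  have hsum : ∑ i, depRate g mu x i * (2 * r (x i) - 1) ≤
      (∑ i, mu i) * (2 * r m - 1) - g * total x + g * N ^ 2 := by
    refine (Finset.sum_le_sum fun i _ => hkey i).trans_eq ?_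
    rw [Finset.sum_add_distrib, Finset.sum_sub_distrib, ← Finset.sum_mul, ← Finset.mul_sum]
    simp [total, ← hNdef]
    ring
  have hgen : jump hn g mu (lyapunov n) x - (1 + depSum g mu x) * lyapunov n x =
      lyapunov n x * ((1 + 1 / N) * (1 - 2 / (N + 2) * r m) - 1 +
        1 / (N + 1) * ∑ i, depRate g mu x i * (2 * r (x i) - 1)) := by
    unfold jump depSum
    rw [hadd, Finset.sum_congr rfl fun i _ => hdep i, ← Finset.mul_sum, Finset.mul_sum (a := 1 / (N + 1))]
    have : ∀ i, 1 / (N + 1) * (depRate g mu x i * (2 * r (x i) - 1)) =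
        depRate g mu x i * (N / (N + 1) * (1 + 2 / N * r (x i))) - depRate g mu x i := by
      intro i
      field_simp
      ring
    simp only [this, Finset.sum_sub_distrib]
    ring
  rw [hgen, mul_qHat hg, mul_left_comm]
  refine mul_le_mul_of_nonneg_left ?_ (lyapunov_pos hn x).le
  set ρ := ∑ i, mu i
  set S := ∑ i, depRate g mu x i * (2 * r (x i) - 1)
  have h5 : 1 / (N + 1) * S ≤
      1 / (N + 1) * (ρ * (2 * r m - 1) - g * total x + g * N ^ 2) := by gcongr
  have h6 : (1 + 1 / N) * (1 - 2 / (N + 2) * r m) - 1 +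
      1 / (N + 1) * (ρ * (2 * r m - 1) - g * total x + g * N ^ 2) =
      1 / (N + 1) * (1 / N + g * N ^ 2 - (g * total x - (1 - ρ))) -
      2 * r m * ((1 + 1 / N) / (N + 2) - ρ / (N + 1)) := by
    field_simp
    ring
  -- The decrease of the product at an arrival outweighs the `r m` terms of the departures, because
  -- `ρ ≤ 1` and `(N + 1) ^ 2 ≥ N * (N + 2)`.
  have h7 : 0 ≤ (1 + 1 / N) / (N + 2) - ρ / (N + 1) := by
    have h8 : ρ / (N + 1) ≤ 1 / (N + 1) := by gcongr
    have h9 : 1 / (N + 1) ≤ (1 + 1 / N) / (N + 2) := by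
      rw [div_le_div_iff₀ (by positivity) (by positivity)]
      have : (1 + 1 / N) * (N + 1) = N + 2 + 1 / N := by field_simp; ring
      rw [this]
      have : 0 < 1 / N := by positivity
      linarith
    linarith
  have := mul_nonneg (mul_nonneg zero_le_two (hr0 m).le) h7
  linarith

theorem one_add_depSum_le {g : ℝ} {mu : Fin n → ℝ} (hg : 0 ≤ g)
    (hmu : ∀ i, 0 ≤ mu i) (hmu1 : ∑ i, mu i ≤ 1) (x : Fin n → ℕ) :
    |1 + depSum g mu x| ≤ g * total x + 2 := by
  rw [abs_of_nonneg (by linarith [depSum_nonneg hg hmu x])]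
  linarith [depSum_le (g := g) hmu x]

theorem abs_mul_qHat_le {g : ℝ} (hg : 0 < g) {mu : Fin n → ℝ}
    (hmu : ∀ i, 0 ≤ mu i) (hmu1 : ∑ i, mu i ≤ 1) (x : Fin n → ℕ) :
    |g * qHat 1 g mu x| ≤ g * total x + 1 := by
  have h0 : 0 ≤ ∑ i, mu i := Finset.sum_nonneg fun i _ => hmu i
  have h1 : 0 ≤ g * (total x : ℝ) := by positivity
  rw [mul_qHat hg, abs_le]
  constructor <;> linarith

theorem integral_abs_mul_qHat_le (hn : 0 < n) {g : ℝ} {mu : Fin n → ℝ} (hg : 0 < g)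
    (hmu : ∀ i, 0 ≤ mu i) (hmu1 : ∑ i, mu i ≤ 1) {π : Measure (Fin n → ℕ)}
    (hπ : IsStationary 1 g mu π) :
    Integrable (fun x => g * qHat 1 g mu x) π ∧ ∫ x, |g * qHat 1 g mu x| ∂π ≤ 2 := by
  have := hπ.1
  obtain ⟨h1, h2⟩ := integral_total_le hn hg hmu hπ
  have h3 : Integrable (fun x => g * (total x : ℝ) + 1) π := (h1.const_mul g).add (integrable_const 1)
  have h4 : Integrable (fun x => g * qHat 1 g mu x) π :=
    h3.mono' Measurable.of_discrete.aestronglyMeasurable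
      (Filter.Eventually.of_forall fun x => abs_mul_qHat_le hg hmu hmu1 x)
  refine ⟨h4, (integral_mono h4.abs h3 fun x => abs_mul_qHat_le hg hmu hmu1 x).trans ?_⟩
  rw [integral_add (h1.const_mul g) (integrable_const _), integral_const_mul, integral_const,
    probReal_univ, one_smul]
  linarith

theorem exp_mul_total (hn : 0 < n) (x : Fin n → ℕ) :
    Real.exp (Real.log (1 + 1 / n) * total x) = (1 + 1 / (n : ℝ)) ^ total x := by
  have : (0 : ℝ) < n := by exact_mod_cast hn
  rw [mul_comm, Real.exp_nat_mul, Real.exp_log (by positivity)]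

theorem integral_lyapunov_mul_le (hn : 0 < n) {g : ℝ} {mu : Fin n → ℝ} (hg : 0 < g)
    (hmu : ∀ i, 0 ≤ mu i) (hmu1 : ∑ i, mu i ≤ 1) {π : Measure (Fin n → ℕ)}
    (hπ : IsStationary 1 g mu π) :
    Integrable (lyapunov n) π ∧
      Integrable (fun x => lyapunov n x * (g * qHat 1 g mu x - (1 / n + g * n ^ 2))) π ∧
      ∫ x, lyapunov n x * (g * qHat 1 g mu x - (1 / n + g * n ^ 2)) ∂π ≤ 0 := by
  have hN : (0 : ℝ) < n := by exact_mod_cast hn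
  have ht : (1 : ℝ) ≤ 1 + 1 / n := by
    have : (0 : ℝ) < 1 / n := by positivity
    linarith
  have hV : ∀ x : Fin n → ℕ, |lyapunov n x| ≤ 2 ^ n * (1 + 1 / (n : ℝ)) ^ total x := fun x => by
    rw [abs_of_pos (lyapunov_pos hn x)]
    exact lyapunov_le hn x
  obtain ⟨h1, h2⟩ := integral_generator hn hg.le hmu hπ (fun x => (lyapunov_pos hn x).le)
    (integrable_mul_of_growth hn hg hmu hπ ht hg.le zero_le_two hV
      (one_add_depSum_le hg.le hmu hmu1))
  have hi0 : Integrable (lyapunov n) π := by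
    have := integrable_mul_of_growth hn hg hmu hπ (k := fun _ => 1) ht hg.le zero_le_one hV
      fun x => by
        rw [abs_one]
        have : 0 ≤ g * (total x : ℝ) := by positivity
        linarith
    simpa using this
  have hi1 : Integrable (fun x => lyapunov n x * (g * qHat 1 g mu x - (1 / n + g * n ^ 2))) π := by
    have := integrable_mul_of_growth hn hg hmu hπ (k := fun x => g * qHat 1 g mu x) ht hg.le
      zero_le_one hV (abs_mul_qHat_le hg hmu hmu1)
    refine (this.sub (hi0.mul_const (1 / n + g * n ^ 2))).congr
      (Filter.Eventually.of_forall fun x => ?_)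
    simp only [Pi.sub_apply]
    ring
  refine ⟨hi0, hi1, ?_⟩
  have h3 := integral_mono h1 (hi1.const_mul (-(1 / ((n : ℝ) + 1)))) fun x =>
    (generator_lyapunov_le hn hg hmu hmu1 x).trans_eq (by ring)
  rw [h2, integral_const_mul] at h3
  have h4 : 0 < 1 / ((n : ℝ) + 1) := by positivity
  nlinarith

/-- The weight of the lower tail, `(1 + 1 / n) ^ (-total x)`. -/
noncomputable def lowerWeight (n : ℕ) (x : Fin n → ℕ) : ℝ := ((n : ℝ) / (n + 1)) ^ total x

/-- Departures increase this weight, so only the upper bound `g * total + ρ` on their rate matters.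
Empty queues help, and no correction factor is needed. -/
theorem generator_lowerWeight_le (hn : 0 < n) {g : ℝ} {mu : Fin n → ℝ} (hg : 0 < g)
    (hmu : ∀ i, 0 ≤ mu i) (x : Fin n → ℕ) :
    jump hn g mu (lowerWeight n) x - (1 + depSum g mu x) * lowerWeight n x ≤
      1 / n * (lowerWeight n x * (1 / n - -(g * qHat 1 g mu x))) := by
  have hN : (0 : ℝ) < n := by exact_mod_cast hn
  have h1 : jump hn g mu (lowerWeight n) x = (n / (n + 1)) ^ (total x + 1) +
      depSum g mu x * ((n : ℝ) / (n + 1)) ^ (total x - 1) :=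
    jump_comp_total hn g mu (fun k => ((n : ℝ) / (n + 1)) ^ k) x
  have h2 : jump hn g mu (lowerWeight n) x - (1 + depSum g mu x) * lowerWeight n x =
      1 / n * (lowerWeight n x * (depSum g mu x - n / (n + 1))) := by
    rw [h1]
    unfold lowerWeight
    rcases Nat.eq_zero_or_pos (total x) with h | h
    · rw [depSum_eq_zero h, h, zero_add, pow_one, pow_zero]
      field_simp
      ring
    · obtain ⟨k, hk⟩ : ∃ k, total x = k + 1 := ⟨total x - 1, by omega⟩
      rw [hk, Nat.add_sub_cancel, pow_succ, pow_succ]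
      field_simp
      ring
  rw [h2]
  have h3 : 0 < lowerWeight n x := by unfold lowerWeight; positivity
  have h4 := depSum_le (g := g) hmu x
  have h5 : 1 - (n : ℝ) / (n + 1) ≤ 1 / n := by
    have : 1 - (n : ℝ) / (n + 1) = 1 / (n + 1) := by field_simp; ring
    rw [this]
    gcongr
    linarith
  have h6 : depSum g mu x - n / (n + 1) ≤ 1 / n - -(g * qHat 1 g mu x) := by
    rw [mul_qHat hg]
    linarith
  gcongr

theorem integral_lowerWeight_mul_le (hn : 0 < n) {g : ℝ} {mu : Fin n → ℝ} (hg : 0 < g)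
    (hmu : ∀ i, 0 ≤ mu i) (hmu1 : ∑ i, mu i ≤ 1) {π : Measure (Fin n → ℕ)}
    (hπ : IsStationary 1 g mu π) :
    Integrable (lowerWeight n) π ∧
      Integrable (fun x => lowerWeight n x * (-(g * qHat 1 g mu x) - 1 / n)) π ∧
      ∫ x, lowerWeight n x * (-(g * qHat 1 g mu x) - 1 / n) ∂π ≤ 0 := by
  have := hπ.1
  have hN : (0 : ℝ) < n := by exact_mod_cast hn
  have hW0 : ∀ x : Fin n → ℕ, 0 ≤ lowerWeight n x := fun x => by unfold lowerWeight; positivity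
  have hW1 : ∀ x : Fin n → ℕ, lowerWeight n x ≤ 1 := fun x =>
    pow_le_one₀ (by positivity) ((div_le_one (by positivity)).2 (by linarith))
  have hW : ∀ x : Fin n → ℕ, |lowerWeight n x| ≤ 1 * 1 ^ total x := fun x => by
    rw [abs_of_nonneg (hW0 x)]
    simpa using hW1 x
  obtain ⟨h1, h2⟩ := integral_generator hn hg.le hmu hπ hW0
    (integrable_mul_of_growth hn hg hmu hπ le_rfl hg.le zero_le_two hW
      (one_add_depSum_le hg.le hmu hmu1))
  have hi0 : Integrable (lowerWeight n) π :=
    integrable_of_bounded 1 fun x => by simpa using hW x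
  have hi1 : Integrable (fun x => lowerWeight n x * (-(g * qHat 1 g mu x) - 1 / n)) π := by
    have := integrable_mul_of_growth hn hg hmu hπ (k := fun x => g * qHat 1 g mu x) le_rfl hg.le
      zero_le_one hW (abs_mul_qHat_le hg hmu hmu1)
    refine (this.neg.sub (hi0.mul_const (1 / n : ℝ))).congr
      (Filter.Eventually.of_forall fun x => ?_)
    simp only [Pi.sub_apply, Pi.neg_apply]
    ring
  refine ⟨hi0, hi1, ?_⟩
  have h3 := integral_mono h1 (hi1.const_mul (-(1 / (n : ℝ)))) fun x =>
    (generator_lowerWeight_le hn hg hmu x).trans_eq (by ring)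
  rw [h2, integral_const_mul] at h3
  have h4 : 0 < 1 / (n : ℝ) := by positivity
  nlinarith

theorem le_log_one_add_inv (hn : 0 < n) : 2 / (3 * n) ≤ Real.log (1 + 1 / n) := by
  have hN : (1 : ℝ) ≤ n := by exact_mod_cast hn
  have h := Real.le_log_one_add_of_nonneg (x := 1 / (n : ℝ)) (by positivity)
  refine le_trans ?_ h
  have : 2 * (1 / (n : ℝ)) / (1 / n + 2) = 2 / (2 * n + 1) := by
    field_simp
    ring
  rw [this]
  gcongr
  linarith

/-- `log x` is concave: beyond `T`, `p * log x` grows with slope at most `p / T`. -/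
theorem rpow_le_rpow_mul_exp {x T p a : ℝ} (hT : 0 < T) (hx : T ≤ x) (hp : 0 < p)
    (ha : p / T ≤ a) : x ^ p ≤ T ^ p * Real.exp (a * (x - T)) := by
  have h1 : x = T * (x / T) := by field_simp
  have h2 : x / T ≤ Real.exp (x / T - 1) := by
    have := Real.add_one_le_exp (x / T - 1)
    linarith
  have hx0 : 0 < x := hT.trans_le hx
  calc x ^ p = (T * (x / T)) ^ p := by rw [← h1]
    _ = T ^ p * (x / T) ^ p := Real.mul_rpow hT.le (by positivity)
    _ ≤ T ^ p * Real.exp (x / T - 1) ^ p := by gcongr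
    _ = T ^ p * Real.exp (p / T * (x - T)) := by
      rw [← Real.exp_mul]
      congr 2
      field_simp
    _ ≤ T ^ p * Real.exp (a * (x - T)) := by
      have := sub_nonneg.2 hx
      gcongr

/-- Exponential smallness of the tails beyond the level `3 / (2 * n * g)`. -/
theorem exp_tail_numeric (hn : 0 < n) {g : ℝ} (hg : 0 < g)
    (hgn : g ≤ 1 / (1152 * n ^ 3 * 2 ^ n)) {c : ℝ} (hc : c ≤ 9 / (8 * n)) :
    2 ^ n * Real.exp (Real.log (1 + 1 / n) * (5 / (4 * n) / g - 3 / (2 * n * g))) * (c + 2) /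
      (5 / (4 * n) - c) ≤ 1 / 6 := by
  have hN : (1 : ℝ) ≤ n := by exact_mod_cast hn
  have hN0 : (0 : ℝ) < n := by linarith
  have ha := le_log_one_add_inv hn
  set a := Real.log (1 + 1 / n)
  have ha0 : 0 < a := lt_of_lt_of_le (by positivity) ha
  have h1 : a * (5 / (4 * n) / g - 3 / (2 * n * g)) = -(a / (4 * n * g)) := by
    field_simp
    ring
  have h2 : Real.exp (-(a / (4 * n * g))) ≤ 6 * n ^ 2 * g := by
    rw [Real.exp_neg, inv_le_comm₀ (Real.exp_pos _) (by positivity)]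
    have h3 : (6 * n ^ 2 * g)⁻¹ = 2 / (3 * n) / (4 * n * g) := by
      field_simp
      norm_num
    have h4 : 2 / (3 * n) / (4 * n * g) ≤ a / (4 * n * g) := by gcongr
    have := Real.add_one_le_exp (a / (4 * n * g))
    linarith
  have h5 : 1 / (8 * n) ≤ 5 / (4 * n) - c := by
    have : 5 / (4 * (n : ℝ)) - 9 / (8 * n) = 1 / (8 * n) := by
      field_simp
      norm_num
    linarith
  have h6 : c + 2 ≤ 4 := by
    have : 9 / (8 * (n : ℝ)) ≤ 2 := by
      rw [div_le_iff₀ (by positivity)]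
      linarith
    linarith
  have h7 : (0 : ℝ) < 1 / (8 * n) := by positivity
  -- The gap between `5 / (4 * n)` and `6 / (4 * n)` supplies the small exponential, at most `6 * n
  -- ^ 2 * g`. The constant is `1152 = 6 * 8 * 24`.
  rw [h1, div_le_iff₀ (by linarith)]
  calc (2 : ℝ) ^ n * Real.exp (-(a / (4 * n * g))) * (c + 2)
      ≤ 2 ^ n * Real.exp (-(a / (4 * n * g))) * 4 := by gcongr
    _ ≤ 2 ^ n * (6 * n ^ 2 * g) * 4 := by gcongr
    _ ≤ 2 ^ n * (6 * n ^ 2 * (1 / (1152 * n ^ 3 * 2 ^ n))) * 4 := by gcongr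
    _ = 1 / 6 * (1 / (8 * n)) := by
      field_simp
      norm_num
    _ ≤ 1 / 6 * (5 / (4 * n) - c) := by gcongr

/-- Levels of `g * qHat`: the Lyapunov drift is controlled by `c ≤ 9 / (8 * n)`, the tail is cut at
`d = 5 / (4 * n)`, and the exponential is normalised at `6 / (4 * n)`. The function `F` is the
Lyapunov function restricted to the tail and rescaled. -/
theorem integral_exp_upper_tail_le (hn : 0 < n) {g : ℝ} {mu : Fin n → ℝ} (hg : 0 < g)
    (hgn : g ≤ 1 / (1152 * n ^ 3 * 2 ^ n))
    (hmu : ∀ i, 0 ≤ mu i) (hmu1 : ∑ i, mu i ≤ 1) {π : Measure (Fin n → ℕ)}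
    (hπ : IsStationary 1 g mu π) :
    ∃ F : (Fin n → ℕ) → ℝ, Integrable F π ∧ ∫ x, F x ∂π ≤ 1 / 6 ∧ (∀ x, 0 ≤ F x) ∧
      ∀ x, 3 / (2 * n * g) ≤ qHat 1 g mu x →
        Real.exp (Real.log (1 + 1 / n) * (qHat 1 g mu x - 3 / (2 * n * g))) ≤ F x := by
  have := hπ.1
  have hN : (1 : ℝ) ≤ n := by exact_mod_cast hn
  have hN0 : (0 : ℝ) < n := by linarith
  obtain ⟨h1, h2, h3⟩ := integral_lyapunov_mul_le hn hg hmu hmu1 hπ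
  obtain ⟨h4, h5⟩ := integral_abs_mul_qHat_le hn hg hmu hmu1 hπ
  have hc : 1 / (n : ℝ) + g * n ^ 2 ≤ 9 / (8 * n) := by
    have h6 : g * (n : ℝ) ^ 2 ≤ 1 / (1152 * n ^ 3 * 2 ^ n) * n ^ 2 := by gcongr
    have h7 : 1 / (1152 * (n : ℝ) ^ 3 * 2 ^ n) * n ^ 2 = 1 / (8 * n) * (1 / (144 * 2 ^ n)) := by
      field_simp
      norm_num
    have h8 : (1 : ℝ) / (144 * 2 ^ n) ≤ 1 := by
      rw [div_le_one (by positivity)]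
      have : (1 : ℝ) ≤ 2 ^ n := one_le_pow₀ (by norm_num)
      linarith
    have h9 : 1 / (8 * (n : ℝ)) * (1 / (144 * 2 ^ n)) ≤ 1 / (8 * n) * 1 := by gcongr
    have : 9 / (8 * (n : ℝ)) = 1 / n + 1 / (8 * n) := by
      field_simp
      norm_num
    linarith
  have hcd : 1 / (n : ℝ) + g * n ^ 2 < 5 / (4 * n) := by
    refine hc.trans_lt ?_
    rw [div_lt_div_iff₀ (by positivity) (by positivity)]
    nlinarith
  set a := Real.log (1 + 1 / n) with ha
  have ha0 : 0 < a := lt_of_lt_of_le (by positivity) (le_log_one_add_inv hn)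
  set q := (1 - ∑ i, mu i) / g with hq
  set B := 2 ^ n * Real.exp (a * (q + 5 / (4 * n) / g)) with hB
  have h6 := integral_tail_le (π := π) (z := fun x => g * qHat 1 g mu x) (U := lyapunov n)
    (B := B) (by positivity) hcd (by positivity) (fun x => (lyapunov_pos hn x).le)
    (fun x hx => by
      refine (lyapunov_le hn x).trans ?_
      rw [← exp_mul_total hn, hB]
      have h7 : qHat 1 g mu x < 5 / (4 * n) / g := by
        rw [lt_div_iff₀ hg]
        linarith
      rw [qHat_eq] at h7
      gcongr
      linarith) h1 h2 h3 h4 h5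
  refine ⟨fun x => Real.exp (-a * (q + 3 / (2 * n * g))) *
    Set.indicator {x | 5 / (4 * n) ≤ g * qHat 1 g mu x} (lyapunov n) x,
    (h1.indicator MeasurableSet.of_discrete).const_mul _, ?_,
    fun x => mul_nonneg (Real.exp_pos _).le
      (Set.indicator_nonneg (fun x _ => (lyapunov_pos hn x).le) x), ?_⟩
  · rw [integral_const_mul]
    refine le_trans (mul_le_mul_of_nonneg_left h6 (Real.exp_pos _).le) ?_
    refine le_of_eq_of_le ?_ (exp_tail_numeric hn hg hgn hc)
    have : Real.exp (a * (5 / (4 * n) / g - 3 / (2 * n * g))) =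
        Real.exp (-a * (q + 3 / (2 * n * g))) * Real.exp (a * (q + 5 / (4 * n) / g)) := by
      rw [← Real.exp_add]
      congr 1
      ring
    rw [← ha, this, hB]
    ring
  · intro x hx
    have hmem : x ∈ {x | 5 / (4 * n) ≤ g * qHat 1 g mu x} := by
      have h8 : g * (3 / (2 * n * g)) ≤ g * qHat 1 g mu x := by gcongr
      have h9 : g * (3 / (2 * n * g)) = 6 / (4 * n) := by
        field_simp
        norm_num
      have h10 : 5 / (4 * (n : ℝ)) ≤ 6 / (4 * n) := by gcongr; norm_num
      simp only [Set.mem_ofPred_eq]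
      linarith
    dsimp only
    rw [Set.indicator_of_mem hmem]
    refine le_trans (le_of_eq ?_)
      (mul_le_mul_of_nonneg_left (pow_le_lyapunov hn x) (Real.exp_pos _).le)
    rw [← exp_mul_total hn, ← Real.exp_add, qHat_eq]
    congr 1
    ring

theorem integral_exp_lower_tail_le (hn : 0 < n) {g : ℝ} {mu : Fin n → ℝ} (hg : 0 < g)
    (hgn : g ≤ 1 / (1152 * n ^ 3 * 2 ^ n))
    (hmu : ∀ i, 0 ≤ mu i) (hmu1 : ∑ i, mu i ≤ 1) {π : Measure (Fin n → ℕ)}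
    (hπ : IsStationary 1 g mu π) :
    ∃ F : (Fin n → ℕ) → ℝ, Integrable F π ∧ ∫ x, F x ∂π ≤ 1 / 6 ∧ (∀ x, 0 ≤ F x) ∧
      ∀ x, 3 / (2 * n * g) ≤ -qHat 1 g mu x →
        Real.exp (Real.log (1 + 1 / n) * (-qHat 1 g mu x - 3 / (2 * n * g))) ≤ F x := by
  have := hπ.1
  have hN : (1 : ℝ) ≤ n := by exact_mod_cast hn
  have hN0 : (0 : ℝ) < n := by linarith
  obtain ⟨h1, h2, h3⟩ := integral_lowerWeight_mul_le hn hg hmu hmu1 hπ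
  obtain ⟨h4, h5⟩ := integral_abs_mul_qHat_le hn hg hmu hmu1 hπ
  have hW0 : ∀ x : Fin n → ℕ, 0 ≤ lowerWeight n x := fun x => by unfold lowerWeight; positivity
  have hc : 1 / (n : ℝ) ≤ 9 / (8 * n) := by
    rw [div_le_div_iff₀ (by positivity) (by positivity)]
    nlinarith
  have hcd : 1 / (n : ℝ) < 5 / (4 * n) := by
    rw [div_lt_div_iff₀ (by positivity) (by positivity)]
    nlinarith
  set a := Real.log (1 + 1 / n) with ha
  have ha0 : 0 < a := lt_of_lt_of_le (by positivity) (le_log_one_add_inv hn)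
  have hW : ∀ x : Fin n → ℕ, lowerWeight n x = Real.exp (-(a * total x)) := by
    intro x
    rw [Real.exp_neg, exp_mul_total hn, lowerWeight, ← inv_pow]
    congr 1
    field_simp
  set q := (1 - ∑ i, mu i) / g with hq
  set B := Real.exp (a * (-q + 5 / (4 * n) / g)) with hB
  have h6 := integral_tail_le (π := π) (z := fun x => -(g * qHat 1 g mu x)) (U := lowerWeight n)
    (B := B) (by positivity) hcd (by positivity) hW0
    (fun x hx => by
      rw [hW, hB, ← mul_neg]
      have h7 : -qHat 1 g mu x < 5 / (4 * n) / g := by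
        rw [lt_div_iff₀ hg]
        linarith
      rw [qHat_eq] at h7
      gcongr
      linarith) h1 h2 h3 h4.neg (K := 2) (by simpa only [abs_neg] using h5)
  refine ⟨fun x => Real.exp (a * (q - 3 / (2 * n * g))) *
    Set.indicator {x | 5 / (4 * n) ≤ -(g * qHat 1 g mu x)} (lowerWeight n) x,
    (h1.indicator MeasurableSet.of_discrete).const_mul _, ?_,
    fun x => mul_nonneg (Real.exp_pos _).le
      (Set.indicator_nonneg (fun x _ => hW0 x) x), ?_⟩
  · rw [integral_const_mul]
    refine le_trans (mul_le_mul_of_nonneg_left h6 (Real.exp_pos _).le) ?_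
    refine le_trans ?_ (exp_tail_numeric hn hg hgn hc)
    have : Real.exp (a * (5 / (4 * n) / g - 3 / (2 * n * g))) =
        Real.exp (a * (q - 3 / (2 * n * g))) * Real.exp (a * (-q + 5 / (4 * n) / g)) := by
      rw [← Real.exp_add]
      congr 1
      ring
    rw [← ha, this, ← mul_div_assoc, ← mul_assoc]
    have h8 : (1 : ℝ) ≤ 2 ^ n := one_le_pow₀ (by norm_num)
    have h9 : 0 < 5 / (4 * (n : ℝ)) - 1 / n := by linarith
    refine div_le_div_of_nonneg_right ?_ h9.le
    refine mul_le_mul_of_nonneg_right ?_ (by positivity)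
    exact le_mul_of_one_le_left (by positivity) h8
  · intro x hx
    have hmem : x ∈ {x | 5 / (4 * n) ≤ -(g * qHat 1 g mu x)} := by
      have h8 : g * (3 / (2 * n * g)) ≤ g * -qHat 1 g mu x := by gcongr
      have h9 : g * (3 / (2 * n * g)) = 6 / (4 * n) := by
        field_simp
        norm_num
      have h10 : 5 / (4 * (n : ℝ)) ≤ 6 / (4 * n) := by gcongr; norm_num
      simp only [Set.mem_ofPred_eq]
      linarith
    dsimp only
    rw [Set.indicator_of_mem hmem, hW, ← Real.exp_add, qHat_eq]
    refine le_of_eq ?_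
    congr 1
    ring

/-- The moments of order `p ≤ 1 / (n ^ 2 * g)`. -/
theorem integral_abs_qHat_rpow_le_of_small (hn : 0 < n) {g : ℝ} {mu : Fin n → ℝ} (hg : 0 < g)
    (hgn : g ≤ 1 / (1152 * n ^ 3 * 2 ^ n))
    (hmu : ∀ i, 0 ≤ mu i) (hmu1 : ∑ i, mu i ≤ 1) {π : Measure (Fin n → ℕ)}
    (hπ : IsStationary 1 g mu π) {p : ℝ} (hp : 1 ≤ p) (hpg : g * p * n ^ 2 ≤ 1) :
    ∫ x, |qHat 1 g mu x| ^ p ∂π ≤ (2 / (n * g)) ^ p := by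
  have := hπ.1
  have hN : (1 : ℝ) ≤ n := by exact_mod_cast hn
  have hN0 : (0 : ℝ) < n := by linarith
  have hp0 : 0 < p := by linarith
  obtain ⟨F, hF1, hF2, hF3, hF4⟩ := integral_exp_upper_tail_le hn hg hgn hmu hmu1 hπ
  obtain ⟨G, hG1, hG2, hG3, hG4⟩ := integral_exp_lower_tail_le hn hg hgn hmu hmu1 hπ
  set T := 3 / (2 * n * g) with hT
  have hT0 : 0 < T := by positivity
  -- The range `g * p * n ^ 2 ≤ 1` is exactly `p / T ≤ 2 / (3 * n)`, so the power grows no faster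
  -- than the controlled exponential.
  have ha : p / T ≤ Real.log (1 + 1 / n) := by
    refine le_trans ?_ (le_log_one_add_inv hn)
    rw [hT, div_div_eq_mul_div, div_le_div_iff₀ (by norm_num) (by positivity)]
    nlinarith
  have h : ∀ x, |qHat 1 g mu x| ^ p ≤ T ^ p * (1 + F x + G x) := by
    intro x
    have hTp : 0 < T ^ p := by positivity
    have hF := hF3 x
    have hG := hG3 x
    rcases le_total |qHat 1 g mu x| T with h1 | h1
    · calc |qHat 1 g mu x| ^ p ≤ T ^ p := by gcongr
        _ ≤ T ^ p * (1 + F x + G x) := le_mul_of_one_le_right hTp.le (by linarith)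
    · refine (rpow_le_rpow_mul_exp hT0 h1 hp0 ha).trans ?_
      gcongr
      rcases le_total 0 (qHat 1 g mu x) with h2 | h2
      · rw [abs_of_nonneg h2] at h1 ⊢
        linarith [hF4 x h1]
      · rw [abs_of_nonpos h2] at h1 ⊢
        linarith [hG4 x h1]
  have hi1 : Integrable (fun x => 1 + F x) π := (integrable_const 1).add hF1
  have hi : Integrable (fun x => T ^ p * (1 + F x + G x)) π := (hi1.add hG1).const_mul _
  refine (integral_mono (integral_abs_qHat_rpow_le hn hg hmu hmu1 hπ hp0).1 hi h).trans ?_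
  rw [integral_const_mul, integral_add hi1 hG1,
    integral_add (integrable_const 1) hF1, integral_const, probReal_univ, one_smul]
  -- The two tails add `1 / 6` each, and `4 / 3 * T = 2 / (n * g)`.
  calc T ^ p * (1 + ∫ x, F x ∂π + ∫ x, G x ∂π) ≤ T ^ p * (4 / 3) := by
        gcongr
        linarith
    _ ≤ T ^ p * (4 / 3) ^ p := by
        gcongr
        exact Real.self_le_rpow_of_one_le (by norm_num) hp
    _ = (2 / (n * g)) ^ p := by
        rw [← Real.mul_rpow hT0.le (by norm_num), hT]
        congr 1
        field_simp
        norm_num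

/-! ### Mass of high levels and the lower bound -/

theorem log_one_add_ge {y : ℝ} (hy : 0 ≤ y) : 2 * y / (y + 2) ≤ Real.log (1 + y) :=
  Real.le_log_one_add_of_nonneg hy

/-- Markov's inequality with mean at most `1 / g` puts mass at least `1 / 2` below `2 / g`. Fewer
than `2 / g + 1 ≤ 3 / g` levels share it. -/
theorem exists_total_mass_ge (hn : 0 < n) {g : ℝ} {mu : Fin n → ℝ} (hg : 0 < g) (hg1 : g ≤ 1)
    (hmu : ∀ i, 0 ≤ mu i) {π : Measure (Fin n → ℕ)} (hπ : IsStationary 1 g mu π) :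
    ∃ k : ℕ, (k : ℝ) < 2 / g ∧ g / 6 ≤ π.real {x | total x = k} := by
  have := hπ.1
  obtain ⟨h1, h2⟩ := integral_total_le hn hg hmu hπ
  set m := ⌈2 / g⌉₊ with hm
  have hcover : ∀ x : Fin n → ℕ, 1 ≤ g / 2 * total x +
      ∑ k ∈ Finset.range m, if total x = k then (1 : ℝ) else 0 := by
    intro x
    rw [Finset.sum_ite_eq]
    split_ifs with h
    · have : 0 ≤ g / 2 * (total x : ℝ) := by positivity
      linarith
    · rw [Finset.mem_range, not_lt, hm, Nat.ceil_le, div_le_iff₀ hg] at h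
      linarith
  have hi : ∀ k : ℕ, Integrable (fun x : Fin n → ℕ => if total x = k then (1 : ℝ) else 0) π :=
    fun k => integrable_of_bounded 1 fun x => by split_ifs <;> norm_num
  have hi1 : Integrable (fun x : Fin n → ℕ =>
      ∑ k ∈ Finset.range m, if total x = k then (1 : ℝ) else 0) π :=
    integrable_finsetSum _ fun k _ => hi k
  have h3 := integral_mono (integrable_const (μ := π) (1 : ℝ)) ((h1.const_mul (g / 2)).add hi1)
    hcover
  simp only [Pi.add_apply] at h3
  rw [integral_const, probReal_univ, one_smul, integral_add (h1.const_mul _) hi1,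
    integral_const_mul, integral_finsetSum _ fun k _ => hi k] at h3
  simp only [measureReal_total_eq, one_mul] at h3
  have h4 : 1 / 2 ≤ ∑ k ∈ Finset.range m, π.real {x | total x = k} := by linarith
  by_contra! hc
  have hm0 : 0 < m := Nat.ceil_pos.2 (by positivity)
  have h5 : ∑ k ∈ Finset.range m, π.real {x | total x = k} < ∑ k ∈ Finset.range m, g / 6 := by
    refine Finset.sum_lt_sum_of_nonempty ⟨0, Finset.mem_range.2 hm0⟩ fun k hk => hc k ?_
    exact Nat.lt_ceil.1 (Finset.mem_range.1 hk)
  rw [Finset.sum_const, Finset.card_range, nsmul_eq_mul] at h5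
  have h6 : (m : ℝ) < 2 / g + 1 := Nat.ceil_lt_add_one (by positivity)
  have h7 : (m : ℝ) * (g / 6) ≤ (2 / g + 1) * (g / 6) := by gcongr
  have h8 : (2 / g + 1) * (g / 6) = (2 + g) / 6 := by field_simp
  linarith

/-- Each upward step to a level at most `κ / g` costs a factor at most `1 + κ`, and at most `κ / g`
steps are taken. The starting mass `g / 6` is at least `exp (-6 / g)`. -/
theorem total_mass_ge (hn : 0 < n) {g κ : ℝ} {mu : Fin n → ℝ} (hg : 0 < g) (hg1 : g ≤ 1)
    (hκ : 2 ≤ κ) (hmu : ∀ i, 0 ≤ mu i) (hmu1 : ∑ i, mu i ≤ 1) {π : Measure (Fin n → ℕ)}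
    (hπ : IsStationary 1 g mu π) :
    Real.exp (-(6 + κ * Real.log (1 + κ)) / g) ≤ π.real {x | total x = ⌊κ / g⌋₊} := by
  obtain ⟨k₀, hk₀, hmass⟩ := exists_total_mass_ge hn hg hg1 hmu hπ
  have hκ1 : 1 ≤ 1 + κ := by linarith
  have hstep : ∀ j : ℕ, ((k₀ + j : ℕ) : ℝ) ≤ κ / g →
      g / 6 ≤ (1 + κ) ^ j * π.real {x | total x = k₀ + j} := by
    intro j
    induction j with
    | zero => simpa using fun _ => hmass
    | succ j ih =>
      intro hj
      have h1 := ih (le_trans (by push_cast; linarith) hj)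
      have h2 := (cut_le hn hg.le hmu hπ (k₀ + j)).2
      have h3 : g * (((k₀ + j : ℕ) : ℝ) + 1) + ∑ i, mu i ≤ 1 + κ := by
        rw [le_div_iff₀ hg] at hj
        push_cast at hj ⊢
        linarith
      calc g / 6 ≤ (1 + κ) ^ j * π.real {x | total x = k₀ + j} := h1
        _ ≤ (1 + κ) ^ j * ((1 + κ) * π.real {x | total x = k₀ + j + 1}) := by
          gcongr
          exact h2.trans (by gcongr)
        _ = _ := by rw [pow_succ, mul_assoc]; rfl
  have hle : k₀ ≤ ⌊κ / g⌋₊ := Nat.le_floor (hk₀.le.trans (by gcongr))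
  obtain ⟨j, hj⟩ := Nat.exists_eq_add_of_le hle
  have hfl : ((⌊κ / g⌋₊ : ℕ) : ℝ) ≤ κ / g := Nat.floor_le (by positivity)
  have h := hstep j (by rw [← hj]; exact hfl)
  rw [← hj] at h
  have hjle : (j : ℝ) ≤ κ / g := by
    refine le_trans ?_ hfl
    rw [hj]
    push_cast
    linarith [(Nat.cast_nonneg k₀ : (0 : ℝ) ≤ k₀)]
  have h1 : (1 + κ) ^ j ≤ Real.exp (κ * Real.log (1 + κ) / g) := by
    calc (1 + κ) ^ j = Real.exp (j * Real.log (1 + κ)) := by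
          rw [Real.exp_nat_mul, Real.exp_log (by linarith)]
      _ ≤ Real.exp (κ / g * Real.log (1 + κ)) := by
          have := Real.log_nonneg hκ1
          gcongr
      _ = _ := by congr 1; ring
  have h2 : Real.exp (-(6 / g)) ≤ g / 6 := by
    rw [Real.exp_neg, inv_le_comm₀ (Real.exp_pos _) (by positivity), inv_div]
    linarith [Real.add_one_le_exp (6 / g)]
  have h3 : Real.exp (-(6 / g)) ≤
      Real.exp (κ * Real.log (1 + κ) / g) * π.real {x | total x = ⌊κ / g⌋₊} :=
    h2.trans (h.trans (by gcongr))
  have h4 : Real.exp (-(6 + κ * Real.log (1 + κ)) / g) =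
      Real.exp (-(6 / g)) / Real.exp (κ * Real.log (1 + κ) / g) := by
    rw [← Real.exp_sub]
    congr 1
    ring
  rw [h4, div_le_iff₀' (Real.exp_pos _)]
  exact h3

theorem le_integral_abs_qHat_rpow (hn : 0 < n) {g : ℝ} {mu : Fin n → ℝ} (hg : 0 < g)
    (hg1 : g ≤ 1) (hmu : ∀ i, 0 ≤ mu i) (hmu1 : ∑ i, mu i ≤ 1) {π : Measure (Fin n → ℕ)}
    (hπ : IsStationary 1 g mu π) {p : ℝ} (hp : 1 ≤ p) :
    Real.exp (-(120 / (g * p)) - 135) * (p / Real.log (1 + g * p)) ≤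
      (∫ x, |qHat 1 g mu x| ^ p ∂π) ^ (1 / p) := by
  have := hπ.1
  have hp0 : 0 < p := by linarith
  set y := g * p with hy
  have hy0 : 0 < y := by positivity
  have hlog : 0 < Real.log (1 + y) := Real.log_pos (by linarith)
  set L := y / Real.log (1 + y) with hL
  have hL0 : 0 < L := by positivity
  have hLy : L * Real.log (1 + y) = y := by rw [hL]; field_simp
  have hLle : L ≤ 1 + y := by
    rw [hL, div_le_iff₀ hlog]
    have h1 := log_one_add_ge hy0.le
    have h2 : y / (1 + y) ≤ 2 * y / (y + 2) := by
      rw [div_le_div_iff₀ (by positivity) (by positivity)]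
      nlinarith
    have h3 : (1 + y) * (y / (1 + y)) = y := by field_simp
    calc y = (1 + y) * (y / (1 + y)) := h3.symm
      _ ≤ (1 + y) * Real.log (1 + y) := by
        gcongr
        exact h2.trans h1
  -- Of the extra `2 / g`, one `1 / g` covers the centering and the other the rounding by the floor.
  -- Thus `qHat ≥ L / g = p / log (1 + g * p)` on this level.
  have hmass := total_mass_ge hn hg hg1 (κ := 2 + L) (by linarith) hmu hmu1 hπ
  set j := ⌊(2 + L) / g⌋₊ with hj
  have hpt : ∀ x : Fin n → ℕ, (if total x = j then (L / g) ^ p else 0) ≤ |qHat 1 g mu x| ^ p := by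
    intro x
    split_ifs with h
    · refine Real.rpow_le_rpow (by positivity) (le_trans ?_ (le_abs_self _)) hp0.le
      have h1 : (2 + L) / g < j + 1 := Nat.lt_floor_add_one _
      have h2 : (1 - ∑ i, mu i) / g ≤ 1 / g := by
        gcongr
        linarith [Finset.sum_nonneg fun i (_ : i ∈ Finset.univ) => hmu i]
      have h3 : 1 ≤ 1 / g := (one_le_div hg).2 hg1
      have h4 : (2 + L) / g = 1 / g + 1 / g + L / g := by ring
      rw [qHat_eq, h]
      linarith
    · positivity
  have h1 : (L / g) ^ p * π.real {x | total x = j} ≤ ∫ x, |qHat 1 g mu x| ^ p ∂π := by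
    rw [← measureReal_total_eq]
    refine integral_mono (integrable_of_bounded ((L / g) ^ p) fun x => ?_)
      (integral_abs_qHat_rpow_le hn hg hmu hmu1 hπ hp0).1 hpt
    have : 0 ≤ (L / g) ^ p := by positivity
    split_ifs <;> simp [this, abs_of_nonneg]
  have h2 : (Real.exp (-(120 / y) - 135) * (p / Real.log (1 + y))) ^ p ≤
      ∫ x, |qHat 1 g mu x| ^ p ∂π := by
    refine le_trans ?_ h1
    have h3 : p / Real.log (1 + y) = L / g := by
      rw [hL, hy]
      field_simp
    rw [h3, Real.mul_rpow (Real.exp_pos _).le (by positivity), mul_comm]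
    gcongr
    refine le_trans ?_ hmass
    rw [← Real.exp_mul]
    gcongr
    have h4 : (-(120 / y) - 135) * p = -(120 + 135 * y) / g := by
      rw [hy]
      field_simp
      ring
    rw [h4]
    refine div_le_div_of_nonneg_right (neg_le_neg ?_) hg.le
    have h5 : Real.log (1 + (2 + L)) ≤ 3 + Real.log (1 + y) := by
      have h6 : Real.log (1 + (2 + L)) ≤ Real.log (4 * (1 + y)) := by
        gcongr
        linarith
      rw [Real.log_mul (by norm_num) (by positivity)] at h6
      have := Real.log_le_sub_one_of_pos (x := 4) (by norm_num)
      linarith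
    have h7 : Real.log (1 + y) ≤ y := by
      have := Real.log_le_sub_one_of_pos (x := 1 + y) (by positivity)
      linarith
    have h8 : (2 + L) * Real.log (1 + (2 + L)) ≤ (2 + L) * (3 + Real.log (1 + y)) := by gcongr
    -- With `L ≤ 1 + y`, `L * log (1 + y) = y` and `log (1 + y) ≤ y`, the cost is at most `15 + 6 *
    -- y`, well below `120 + 135 * y`.
    nlinarith
  calc _ = ((Real.exp (-(120 / y) - 135) * (p / Real.log (1 + y))) ^ p) ^ (1 / p) := by
        rw [← Real.rpow_mul (by positivity), mul_one_div_cancel hp0.ne', Real.rpow_one]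
    _ ≤ _ := by gcongr

/-! ### Comparison with the stated constants -/

theorem exp_poly_bound {x : ℝ} (hx : 1 ≤ x) :
    (3 / 1000 * x ^ 4) ^ 2 ≤ 2 * (1 / x * Real.exp x - 1 - 1 / x) := by
  have hx0 : 0 < x := by linarith
  have h := Real.sum_le_exp_of_nonneg hx0.le 11
  simp only [Finset.sum_range_succ, Finset.sum_range_zero, Nat.factorial] at h
  norm_num at h
  have h1 : 2 * (1 / x * Real.exp x - 1 - 1 / x) = 2 * (Real.exp x - x - 1) / x := by
    field_simp
  rw [h1, le_div_iff₀ hx0]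
  -- Only the Taylor terms of degrees 8, 9 and 10 are needed; dividing by `x ^ 8` leaves a quadratic
  -- inequality.
  have hq : 9 / 1000000 * x ≤ 2 * (1 / 40320 + x / 362880 + x ^ 2 / 3628800) := by
    nlinarith [sq_nonneg (x - 7)]
  have h2 := mul_le_mul_of_nonneg_left hq (pow_nonneg hx0.le 8)
  have h3 : 0 ≤ x ^ 2 / 2 + x ^ 3 / 6 + x ^ 4 / 24 + x ^ 5 / 120 + x ^ 6 / 720 + x ^ 7 / 5040 := by
    positivity
  nlinarith

theorem one_div_le_constA (hn : 0 < n) {C α lam M : ℝ} (hC : 0 ≤ C) (hα : α < 1 / 2)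
    (hlam : 0 < lam) (hM : 0 ≤ M) : 1 / n ≤ constA n C α lam M := by
  unfold constA
  refine le_mul_of_one_le_right (by positivity) ?_
  have h1 : 0 < 1 / (1 / 2 - α) + 1 := by
    have : 0 < 1 / 2 - α := by linarith
    positivity
  have h2 := Real.Gamma_pos_of_pos h1
  have h3 : 0 ≤ (C / (2 * n * lam)) ^ (-(1 / (1 / 2 - α))) := by positivity
  have : 0 ≤ n * M * Real.Gamma (1 / (1 / 2 - α) + 1) *
    (C / (2 * n * lam)) ^ (-(1 / (1 / 2 - α))) := by positivity
  linarith

theorem sqrt_constant_bound : (13.58 : ℝ) ≤ 2 * Real.exp 1 * √(2 * Real.pi) := by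
  have h1 := Real.exp_one_gt_d9
  have h2 : (2.5 : ℝ) ≤ √(2 * Real.pi) := by
    apply Real.le_sqrt_of_sq_le
    linarith [Real.pi_gt_d2]
  nlinarith

/-- A lower bound on the sub-Gaussian term of the moment bound, in the range of moments where it
is needed. -/
theorem le_subgaussian_term (hn : 0 < n) {C α lam gam M p : ℝ} (hC : 0 ≤ C) (hα : α < 1 / 2)
    (hlam : 0 < lam) (hgam : 0 < gam) (hM : 0 ≤ M) (hp : 0 < p)
    (h1 : 1 ≤ gam / lam * p * n ^ 2) (h2 : gam / lam * p ≤ n ^ 2) :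
    1.1 * (p / Real.log (1 + gam / lam * p)) ≤
      constC'' * (√p / √gam) + constC' n C α lam M * p := by
  have hN : (1 : ℝ) ≤ n := by exact_mod_cast hn
  have hN0 : (0 : ℝ) < n := by linarith
  have hA := one_div_le_constA hn hC hα hlam hM
  have hk := sqrt_constant_bound
  unfold constC'' constC'
  set k := 2 * Real.exp 1 * √(2 * Real.pi)
  set y := gam / lam * p with hy
  have hy0 : 0 < y := by positivity
  set w := √y with hw
  have hw0 : 0 < w := Real.sqrt_pos.2 hy0
  have hwy : w ^ 2 = y := Real.sq_sqrt hy0.le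
  have hlog : 0 < Real.log (1 + y) := Real.log_pos (by linarith)
  have hwn : 1 ≤ n * w := by
    rw [← hwy] at h1
    by_contra! hc
    nlinarith [mul_pos hN0 hw0]
  have hwn2 : w ≤ n := by
    rw [← hwy] at h2
    exact (abs_le_of_sq_le_sq' h2 hN0.le).2
  have hc : 3 / 1000 * (n : ℝ) ^ 4 * √lam ≤ √(2 * (1 / n * Real.exp n - 1 - 1 / n) * lam) := by
    rw [Real.sqrt_mul' _ hlam.le]
    gcongr
    exact Real.le_sqrt_of_sq_le (exp_poly_bound hN)
  set X := √p / √gam with hX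
  have hX0 : 0 < X := div_pos (Real.sqrt_pos.2 hp) (Real.sqrt_pos.2 hgam)
  set Y := (constA n C α lam M + 1 / n) * √(2 * (1 / n * Real.exp n - 1 - 1 / n) * lam) * p with hY
  set Y₀ := 2 / n * (3 / 1000 * (n : ℝ) ^ 4 * √lam) * p with hY₀
  have hYY : Y₀ ≤ Y := by
    have : 2 / (n : ℝ) ≤ constA n C α lam M + 1 / n := by
      have : 2 / (n : ℝ) = 1 / n + 1 / n := by ring
      linarith
    rw [hY, hY₀]
    have h0 : (0 : ℝ) ≤ 2 / n := by positivity
    exact mul_le_mul_of_nonneg_right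
      (mul_le_mul this hc (by positivity) (h0.trans this)) hp.le
  -- The summands `X` and `Y₀` depend on the unit of time, but their product depends only on `n`,
  -- `p` and `g`. AM-GM therefore gives a bound free of `lam`.
  have hXY : X * Y₀ = 6 / 1000 * n ^ 3 * p ^ 2 / w := by
    have hs1 : w = √gam / √lam * √p := by
      rw [hw, hy, Real.sqrt_mul (by positivity), Real.sqrt_div hgam.le]
    have hs2 := Real.sqrt_pos.2 hlam
    have hs3 := Real.sqrt_pos.2 hgam
    have hs4 := Real.sqrt_pos.2 hp
    rw [hX, hY₀, hs1]
    have hs5 : p = √p ^ 2 := (Real.sq_sqrt hp.le).symm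
    have hs6 : p ^ 2 = p * √p ^ 2 := by rw [← hs5, sq]
    rw [hs6]
    field_simp
    norm_num
  have hrw : k * X + (constA n C α lam M + 1 / n) *
      √(2 * (1 / n * Real.exp n - 1 - 1 / n) * lam) * k * p = k * (X + Y) := by
    rw [hY]
    ring
  rw [hrw]
  have hY0 : 0 ≤ Y₀ := by positivity
  have hl := log_one_add_ge hy0.le
  -- For `y ≤ 1` use `log (1 + y) ≥ 2 * y / 3` and `n * w ≥ 1`; for `y ≥ 1` use `log (1 + y) ≥ 2 /
  -- 3` and `w ≤ n`. Here `1.21 = 1.1 ^ 2`, and `4.4` is just below `4 * 13.58 ^ 2 * 6 / 1000`.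
  have hkey : 1.21 * w ≤ 4.4 * n ^ 3 * Real.log (1 + y) ^ 2 := by
    have hn3 : 1 ≤ (n : ℝ) ^ 3 := one_le_pow₀ hN
    rcases le_total y 1 with h | h
    · have h3 : 2 / 3 * w ^ 2 ≤ Real.log (1 + y) := by
        refine le_trans ?_ hl
        rw [hwy, le_div_iff₀ (by positivity)]
        nlinarith
      have h4 : (2 / 3 * w ^ 2) ^ 2 ≤ Real.log (1 + y) ^ 2 := by gcongr
      have h5 : 1 ≤ (n * w) ^ 3 := one_le_pow₀ hwn
      calc 1.21 * w ≤ 1.21 * w * (n * w) ^ 3 := le_mul_of_one_le_right (by positivity) h5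
        _ ≤ 4.4 * n ^ 3 * (2 / 3 * w ^ 2) ^ 2 := by
          have e1 : 1.21 * w * (n * w) ^ 3 = 1.21 * (n ^ 3 * w ^ 4) := by ring
          have e2 : 4.4 * n ^ 3 * (2 / 3 * w ^ 2) ^ 2 = 4.4 * (4 / 9) * (n ^ 3 * w ^ 4) := by ring
          rw [e1, e2]
          gcongr
          norm_num
        _ ≤ _ := by gcongr
    · have h3 : 2 / 3 ≤ Real.log (1 + y) := by
        refine le_trans ?_ hl
        rw [le_div_iff₀ (by positivity)]
        linarith
      have h4 : (2 / 3 : ℝ) ^ 2 ≤ Real.log (1 + y) ^ 2 := by gcongr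
      have h6 : (n : ℝ) ≤ n ^ 3 := le_self_pow₀ hN (by norm_num)
      calc 1.21 * w ≤ 4.4 * n ^ 3 * (2 / 3) ^ 2 := by linarith
        _ ≤ _ := by gcongr
  have hsq : (1.1 * (p / Real.log (1 + y))) ^ 2 ≤ (k * (X + Y₀)) ^ 2 := by
    have h3 : (1.1 * (p / Real.log (1 + y))) ^ 2 = 1.21 * p ^ 2 / Real.log (1 + y) ^ 2 := by
      rw [mul_pow, div_pow]
      norm_num
      ring
    have h4 : 1.21 * p ^ 2 / Real.log (1 + y) ^ 2 ≤ 4.4 * n ^ 3 * p ^ 2 / w := by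
      rw [div_le_div_iff₀ (by positivity) hw0]
      calc 1.21 * p ^ 2 * w = p ^ 2 * (1.21 * w) := by ring
        _ ≤ p ^ 2 * (4.4 * n ^ 3 * Real.log (1 + y) ^ 2) := by gcongr
        _ = _ := by ring
    have h5 : 4.4 * n ^ 3 * p ^ 2 / w ≤ 4 * k ^ 2 * (X * Y₀) := by
      rw [hXY]
      have h6 : 4.4 ≤ 4 * k ^ 2 * (6 / 1000) := by
        have : (13.58 : ℝ) ^ 2 ≤ k ^ 2 := by gcongr
        norm_num at this
        linarith
      have h7 : 0 ≤ n ^ 3 * p ^ 2 / w := by positivity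
      calc 4.4 * n ^ 3 * p ^ 2 / w = 4.4 * (n ^ 3 * p ^ 2 / w) := by ring
        _ ≤ 4 * k ^ 2 * (6 / 1000) * (n ^ 3 * p ^ 2 / w) := by gcongr
        _ = _ := by ring
    have h8 : 4 * k ^ 2 * (X * Y₀) ≤ (k * (X + Y₀)) ^ 2 := by
      have : (k * (X + Y₀)) ^ 2 = 4 * k ^ 2 * (X * Y₀) + (k * (X - Y₀)) ^ 2 := by ring
      linarith [sq_nonneg (k * (X - Y₀))]
    linarith
  have hk0 : 0 < k := by linarith
  calc 1.1 * (p / Real.log (1 + y)) ≤ k * (X + Y₀) :=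
        (abs_le_of_sq_le_sq' hsq (by positivity)).2
    _ ≤ k * (X + Y) := by gcongr

theorem le_subexponential_term (hn : 0 < n) {C α lam gam M p : ℝ} (hC : 0 ≤ C) (hα : α < 1 / 2)
    (hlam : 0 < lam) (hgam : 0 < gam) (hM : 0 ≤ M) (hp : 0 < p) :
    2 * (p / Real.log (1 + n * (gam / lam * p))) ≤
      n * (constA n C α lam M + 1 / n) * (p / Real.log (1 + n * gam / lam * p)) := by
  have hN0 : (0 : ℝ) < n := by exact_mod_cast hn
  have hA := one_div_le_constA hn hC hα hlam hM
  have h1 : n * gam / lam * p = n * (gam / lam * p) := by ring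
  rw [h1]
  have hlog : 0 < Real.log (1 + n * (gam / lam * p)) := Real.log_pos (by
    have : 0 < n * (gam / lam * p) := by positivity
    linarith)
  gcongr
  have h2 : n * (1 / n + 1 / n) ≤ n * (constA n C α lam M + 1 / n) := by gcongr
  have h3 : (n : ℝ) * (1 / n + 1 / n) = 2 := by
    field_simp
    norm_num
  linarith

/-- The upper bound on the moments. -/
theorem moment_upper_bound (hn : 0 < n) {C α lam gam M p : ℝ} {mu : Fin n → ℝ} (hC : 0 ≤ C)
    (hα : α < 1 / 2) (hlam : 0 < lam) (hgam : 0 < gam) (hM : 0 ≤ M)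
    (hg : gam / lam ≤ 1 / (1152 * n ^ 3 * 2 ^ n))
    (hmu : ∀ i, 0 ≤ mu i) (hmu1 : ∑ i, mu i ≤ 1) {π : Measure (Fin n → ℕ)}
    (hπ : IsStationary 1 (gam / lam) mu π) (hp : 1 ≤ p) :
    (∫ x, |qHat 1 (gam / lam) mu x| ^ p ∂π) ^ (1 / p) ≤
      max (constC'' * (√p / √gam) + constC' n C α lam M * p)
        (n * (constA n C α lam M + 1 / n) * (p / Real.log (1 + n * gam / lam * p))) := by
  have hN : (1 : ℝ) ≤ n := by exact_mod_cast hn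
  have hN0 : (0 : ℝ) < n := by linarith
  have hp0 : 0 < p := by linarith
  have hT := le_subexponential_term hn hC hα hlam hgam hM hp0
  set g := gam / lam with hgdef
  have hg0 : 0 < g := by positivity
  have hI0 : 0 ≤ ∫ x, |qHat 1 g mu x| ^ p ∂π := integral_nonneg fun x => by positivity
  have hroot : ∀ a : ℝ, 0 ≤ a → ∫ x, |qHat 1 g mu x| ^ p ∂π ≤ a ^ p →
      (∫ x, |qHat 1 g mu x| ^ p ∂π) ^ (1 / p) ≤ a := by
    intro a ha h
    calc _ ≤ (a ^ p) ^ (1 / p) := by gcongr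
      _ = a := by rw [← Real.rpow_mul ha, mul_one_div_cancel hp0.ne', Real.rpow_one]
  have hy0 : 0 < g * p := by positivity
  have hny0 : 0 < n * (g * p) := by positivity
  rcases le_total (g * p * n ^ 2) 1 with h | h
  · refine le_trans ?_ ((le_max_right _ _).trans' hT)
    refine (hroot _ (by positivity)
      (integral_abs_qHat_rpow_le_of_small hn hg0 hg hmu hmu1 hπ hp h)).trans ?_
    rw [div_le_iff₀ (by positivity)]
    have hlog : 0 < Real.log (1 + n * (g * p)) := Real.log_pos (by linarith)
    have hl := Real.log_le_sub_one_of_pos (x := 1 + n * (g * p)) (by linarith)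
    have : 2 * (p / Real.log (1 + n * (g * p))) * (n * g) =
        2 * (n * (g * p)) / Real.log (1 + n * (g * p)) := by ring
    rw [this, le_div_iff₀ hlog]
    linarith
  · have hlog : 0 < Real.log (1 + g * p) := Real.log_pos (by linarith)
    -- Outside the small range `p` is large, so the factor `2` of the crude bound costs only `2 ^ (1
    -- / p) ≤ 1.1`.
    have hp8 : 8 ≤ p := by
      have h1 : g * p * n ^ 2 ≤ 1 / (1152 * n ^ 3 * 2 ^ n) * p * n ^ 2 := by gcongr
      have h2 : 1 / (1152 * (n : ℝ) ^ 3 * 2 ^ n) * p * n ^ 2 = p / (1152 * (n * 2 ^ n)) := by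
        field_simp
      have h3 : 1 ≤ (n : ℝ) * 2 ^ n := one_le_mul_of_one_le_of_one_le hN (one_le_pow₀ (by norm_num))
      rw [h2] at h1
      have h4 := h.trans h1
      rw [le_div_iff₀ (by positivity)] at h4
      linarith
    have hcrude : (∫ x, |qHat 1 g mu x| ^ p ∂π) ^ (1 / p) ≤
        1.1 * (p / Real.log (1 + g * p)) := by
      refine hroot _ (by positivity) ?_
      refine (integral_abs_qHat_rpow_le hn hg0 hmu hmu1 hπ hp0).2.trans ?_
      rw [Real.mul_rpow (by norm_num) (by positivity)]
      gcongr
      calc (2 : ℝ) ≤ 1.1 ^ (8 : ℝ) := by norm_num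
        _ ≤ 1.1 ^ p := Real.rpow_le_rpow_of_exponent_le (by norm_num) hp8
    rcases le_total (g * p) (n ^ 2) with h1 | h1
    · exact (hcrude.trans (le_subgaussian_term hn hC hα hlam hgam hM hp0 h h1)).trans
        (le_max_left _ _)
    · refine le_trans (hcrude.trans ?_) ((le_max_right _ _).trans' hT)
      have hlogn : 0 < Real.log (1 + n * (g * p)) := Real.log_pos (by linarith)
      have h2 : Real.log (1 + n * (g * p)) ≤ Real.log n + Real.log (1 + g * p) := by
        rw [← Real.log_mul hN0.ne' (by positivity)]
        gcongr
        linarith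
      -- As `n ^ 2 ≤ g * p`, the extra `log n` is at most half of `log (1 + g * p)`, and `1.1 * 3 /
      -- 2 ≤ 2`.
      have h3 : 2 * Real.log n ≤ Real.log (1 + g * p) := by
        have : 2 * Real.log n = Real.log ((n : ℝ) ^ 2) := by rw [Real.log_pow]; norm_num
        rw [this]
        gcongr
        linarith
      rw [← mul_div_assoc, ← mul_div_assoc, div_le_div_iff₀ hlog hlogn]
      nlinarith

/-- The lower bound on the moments. -/
theorem moment_lower_bound (hn : 0 < n) {C lam gam M p : ℝ} {mu : Fin n → ℝ}
    (hlam : 0 < lam) (hgam : 0 < gam) (hM : 0 ≤ M) (hg : gam / lam ≤ 1)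
    (hmu : ∀ i, 0 ≤ mu i) (hmu1 : ∑ i, mu i ≤ 1) {π : Measure (Fin n → ℕ)}
    (hπ : IsStationary 1 (gam / lam) mu π) (hp : 1 ≤ p) :
    constC4 C lam M * Real.exp (-8 * (15 + constASSQ C lam M) * (lam / (gam * p))) *
        (p / Real.log (1 + p * gam / lam)) ≤
      (∫ x, |qHat 1 (gam / lam) mu x| ^ p ∂π) ^ (1 / p) := by
  have hp0 : 0 < p := by linarith
  have hg0 : 0 < gam / lam := by positivity
  refine le_trans ?_ (le_integral_abs_qHat_rpow hn hg0 hg hmu hmu1 hπ hp)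
  have hA : 0 ≤ constASSQ C lam M := by
    have h1 : 0 ≤ constCSSQ C lam M :=
      mul_nonneg (by positivity) ((Real.exp_pos 1).le.trans (le_max_left _ _))
    unfold constASSQ
    positivity
  have h1 : p * gam / lam = gam / lam * p := by ring
  have h2 : lam / (gam * p) = 1 / (gam / lam * p) := by field_simp
  rw [h1, h2]
  have hy0 : 0 < gam / lam * p := by positivity
  have hlog : 0 < Real.log (1 + gam / lam * p) := Real.log_pos (by linarith)
  refine mul_le_mul_of_nonneg_right ?_ (by positivity)
  have h3 : constC4 C lam M ≤ Real.exp (-135) := by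
    unfold constC4
    calc 29 / 69 * 2 * Real.exp (-9 * (15 + constASSQ C lam M))
        ≤ 1 * Real.exp (-9 * (15 + constASSQ C lam M)) := by gcongr; norm_num
      _ ≤ Real.exp (-135) := by
        rw [one_mul]
        gcongr
        linarith
  have h4 : -8 * (15 + constASSQ C lam M) * (1 / (gam / lam * p)) ≤ -(120 / (gam / lam * p)) := by
    have : 0 ≤ constASSQ C lam M * (1 / (gam / lam * p)) := by positivity
    have h5 : 120 / (gam / lam * p) = 120 * (1 / (gam / lam * p)) := by ring
    rw [h5]
    linarith
  calc _ ≤ Real.exp (-135) * Real.exp (-(120 / (gam / lam * p))) := by gcongr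
    _ = _ := by
      rw [← Real.exp_add]
      congr 1
      ring

/-! ### Reduction to unit arrival rate -/

theorem rate_eq_mul {lam : ℝ} (hlam : lam ≠ 0) (gam : ℝ) (mu : Fin n → ℝ) (x y : Fin n → ℕ) :
    rate lam gam mu x y = lam * rate 1 (gam / lam) (fun i => mu i / lam) x y := by
  unfold rate
  rw [mul_add, Finset.mul_sum, Finset.mul_sum]
  congr 1 <;> refine Finset.sum_congr rfl fun i _ => ?_
  · split_ifs <;> simp
  · split_ifs
    · field_simp
    · simp

/-- Scaling of time. -/
theorem IsStationary.scale {lam gam : ℝ} (hlam : lam ≠ 0) {mu : Fin n → ℝ}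
    {π : Measure (Fin n → ℕ)} (h : IsStationary lam gam mu π) :
    IsStationary 1 (gam / lam) (fun i => mu i / lam) π := by
  refine ⟨h.1, fun y => ?_⟩
  have := h.2 y
  simp only [rate_eq_mul hlam, mul_left_comm _ lam, tsum_mul_left] at this
  exact mul_left_cancel₀ hlam this

theorem qHat_scale {lam gam : ℝ} (hlam : lam ≠ 0) (mu : Fin n → ℝ) :
    qHat lam gam mu = qHat 1 (gam / lam) (fun i => mu i / lam) := by
  ext x
  unfold qHat
  rw [← Finset.sum_div]
  field_simp

end JSQ

theorem proposition6p5 (n : ℕ) (hn : 0 < n) (C α : ℝ) (hC : 1 < C) (hα₀ : 0 ≤ α)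
    (hα : α < 1 / 2) :
    ∃ ε : ℝ, 0 < ε ∧
      ∀ (lam gam : ℝ) (mu : Fin n → ℝ), 0 < lam → 0 < gam → (∀ i, 0 < mu i) →
        JSQ.HeavilyOverloaded C α lam (∑ i, mu i) gam → gam ≤ ε * lam →
        ∀ π : MeasureTheory.Measure (Fin n → ℕ), JSQ.IsStationary lam gam mu π →
          ∀ p : ℝ, 1 ≤ p →
            MeasureTheory.Integrable (fun x => |JSQ.qHat lam gam mu x| ^ p) π ∧
            (∫ x, |JSQ.qHat lam gam mu x| ^ p ∂π) ^ (1 / p) ≤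
              max (JSQ.constC'' * (√p / √gam) + JSQ.constC' n C α lam (∑ i, mu i) * p)
                (n * (JSQ.constA n C α lam (∑ i, mu i) + 1 / n) *
                  (p / Real.log (1 + n * gam / lam * p))) ∧
            JSQ.constC4 C lam (∑ i, mu i) *
                Real.exp (-8 * (15 + JSQ.constASSQ C lam (∑ i, mu i)) * (lam / (gam * p))) *
                (p / Real.log (1 + p * gam / lam)) ≤
              (∫ x, |JSQ.qHat lam gam mu x| ^ p ∂π) ^ (1 / p) := by
  have hN : (1 : ℝ) ≤ n := by exact_mod_cast hn
  -- The threshold comes from `exp_tail_numeric`, the only place that needs `g` this small.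
  refine ⟨1 / (1152 * n ^ 3 * 2 ^ n), by positivity, ?_⟩
  intro lam gam mu hlam hgam hmu hover hε π hπ p hp
  have hp0 : 0 < p := by linarith
  have : Nonempty (Fin n) := ⟨⟨0, hn⟩⟩
  have hM : 0 < ∑ i, mu i := Finset.sum_pos (fun i _ => hmu i) Finset.univ_nonempty
  have hMlam : ∑ i, mu i ≤ lam := by
    have h1 : 0 ≤ C * (gam / ∑ i, mu i) ^ α := by positivity
    have h2 : 1 ≤ lam / ∑ i, mu i := by
      unfold JSQ.HeavilyOverloaded at hover
      linarith
    rwa [le_div_iff₀ hM, one_mul] at h2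
  have hg0 : 0 < gam / lam := by positivity
  have hg : gam / lam ≤ 1 / (1152 * n ^ 3 * 2 ^ n) := (div_le_iff₀ hlam).2 hε
  have hg1 : gam / lam ≤ 1 := by
    refine hg.trans ((div_le_one (by positivity)).2 ?_)
    have h1 : 1 ≤ (n : ℝ) ^ 3 := one_le_pow₀ hN
    have h2 : (1 : ℝ) ≤ 2 ^ n := one_le_pow₀ (by norm_num)
    nlinarith
  have hmu0 : ∀ i, 0 ≤ mu i / lam := fun i => (div_pos (hmu i) hlam).le
  have hmu1 : ∑ i, mu i / lam ≤ 1 := by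
    rw [← Finset.sum_div]
    exact (div_le_one hlam).2 hMlam
  have hπ' := hπ.scale hlam.ne'
  rw [JSQ.qHat_scale hlam.ne']
  exact ⟨(JSQ.integral_abs_qHat_rpow_le hn hg0 hmu0 hmu1 hπ' hp0).1,
    JSQ.moment_upper_bound hn (by linarith) hα hlam hgam hM.le hg hmu0 hmu1 hπ' hp,
    JSQ.moment_lower_bound hn hlam hgam hM.le hg1 hmu0 hmu1 hπ' hp⟩
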